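/- Let $X$ be a metric space and let $\mathscr{H}$ be an ample $X$-module, i.e. a complex Hilbert space with a nondegenerate $*$-representation of $C_0(X)$ in which only $f=0$ acts as a compact operator; for Borel $W\subseteq X$ let $\chi_W$ be the projection given by the extension of the representation to bounded Borel functions. The Roe algebra $C^*_{\mathrm{Roe}}(X)$ is the norm closure in $B(\mathscr{H})$ of the set of operators $T$ that are locally compact ($\chi_WT$ and $T\chi_W$ are compact for all bounded Borel $W$) and have finite propagation (for some $r\ge 0$, $\chi_VT\chi_W=0$ whenever $d(V,W)>r$). For $Y\subseteq X$ let $\{Y\}$ be the family of all $Z\subseteq X$ contained in $B_r(Y)=\{x:\ d(x,y)\le r\text{ for some }y\in Y\}$ for some $r>0$, and let $\partial Y=\{Z\cap Z' : Z\in\{Y\},\,Z'\in\{X\setminus Y\}\}$. For such a family $\mathcal{Y}$, $C^*_{\mathrm{Roe}}(\mathcal{Y})$ is the closed ideal of $C^*_{\mathrm{Roe}}(X)$ obtained as the closure of the set of all $T\in C^*_{\mathrm{Roe}}(X)$ for which there is $Z\in\mathcal{Y}$ with $fT=Tf=0$ for all $f\in C_0(X)$ with support in $X\setminus Z$. One has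 $C^*_{\mathrm{Roe}}(X)=C^*_{\mathrm{Roe}}(\{Y\})+C^*_{\mathrm{Roe}}(\{X\setminus Y\})$ and $C^*_{\mathrm{Roe}}(\{Y\})\cap C^*_{\mathrm{Roe}}(\{X\setminus Y\})=C^*_{\mathrm{Roe}}(\partial Y)$, and the Mayer–Vietoris boundary map $$\partial: K_0(C^*_{\mathrm{Roe}}(X))\to K_0\bigl(C^*_{\mathrm{Roe}}(X)/C^*_{\mathrm{Roe}}(\{X\setminus Y\})\bigr)\cong K_0\bigl(C^*_{\mathrm{Roe}}(\{Y\})/C^*_{\mathrm{Roe}}(\partial Y)\bigr)\xrightarrow{\mathrm{Exp}} K_1(C^*_{\mathrm{Roe}}(\partial Y))$$ is the composition with the exponential map $\mathrm{Exp}[q]=[\exp(2\pi i\tilde q)]$, $\tilde q$ a self-adjoint lift of the projection $q$. Let $H$ be a (possibly unbounded) positive self-adjoint operator on $\mathscr{H}$ with $f(H)\in C^*_{\mathrm{Roe}}(X)$ for all $f\in C_c(\mathbb{R})$. Let $Y\subseteq X$ and let $\tilde H$ be a Hamiltonian on $Y$ adapted to $H$: a (possibly unbounded) self-adjoint operator,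 bounded from below, on $\mathscr{H}$ or, more generally, on a Hilbert space isometrically embedded in $\mathscr{H}$, such that for all $f\in C_0(\mathbb{R})$ $$f(\tilde H)\in C^*_{\mathrm{Roe}}(\{Y\})\quad\text{and}\quad f(H)-f(\tilde H)\in C^*_{\mathrm{Roe}}(\{X\setminus Y\}),$$ where $f(\tilde H)$ is extended by zero to $\mathscr{H}$. Suppose that $H$ is insulating at $E\in\mathbb{R}$, i.e. $E\notin\mathrm{spec}(H)$, and let $[p_E]\in K_0(C^*_{\mathrm{Roe}}(X))$ be the class of the Fermi projection $p_E$, the spectral projection of $H$ for $(-\infty,E)$ (which lies in $C^*_{\mathrm{Roe}}(X)$). If $$\partial([p_E])\neq 0\quad\text{in } K_1(C^*_{\mathrm{Roe}}(\partial Y)),$$ then $E\in\mathrm{spec}(\tilde H)$. -/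

import Mathlib

noncomputable section

set_option linter.unusedSectionVars false
set_option linter.unusedDecidableInType false
set_option linter.unusedVariables false

namespace KTheory

/-- A projection in some matrix algebra `M_ι(B)`, with `ι` a finite index set. -/
structure ProjMatrix (B : Type*) [CStarAlgebra B] where
  ι : Type
  [fin : Fintype ι]
  [dec : DecidableEq ι]
  mat : Matrix ι ι B
  isProj : IsStarProjection mat

/-- A unitary in some matrix algebra `M_ι(B)`, with `ι` a finite index set. -/
structure UnitaryMatrix (B : Type*) [CStarAlgebra B] where
  ι : Type
  [fin : Fintype ι]
  [dec : DecidableEq ι]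
  mat : Matrix ι ι B
  isUnitary : mat ∈ unitary (Matrix ι ι B)

attribute [instance] ProjMatrix.fin ProjMatrix.dec UnitaryMatrix.fin UnitaryMatrix.dec

section

variable {B : Type*} [CStarAlgebra B]
variable {ι κ : Type} [Fintype ι] [Fintype κ]

theorem isStarProjection_reindex {p : Matrix ι ι B} (hp : IsStarProjection p) (e : ι ≃ κ) :
    IsStarProjection (Matrix.reindex e e p) := by
  refine ⟨?_, ?_⟩
  · have := hp.isIdempotentElem.eq
    simp only [IsIdempotentElem, Matrix.reindex_apply, Matrix.submatrix_mul_equiv, this]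
  · have := hp.isSelfAdjoint.star_eq
    rw [Matrix.star_eq_conjTranspose] at this
    simp [IsSelfAdjoint, Matrix.star_eq_conjTranspose, this]

theorem isStarProjection_blocks {p : Matrix ι ι B} {q : Matrix κ κ B}
    (hp : IsStarProjection p) (hq : IsStarProjection q) :
    IsStarProjection (Matrix.fromBlocks p 0 0 q) := by
  refine ⟨?_, ?_⟩
  · have h1 := hp.isIdempotentElem.eq
    have h2 := hq.isIdempotentElem.eq
    simp [IsIdempotentElem, Matrix.fromBlocks_multiply, h1, h2]
  · have h1 := hp.isSelfAdjoint.star_eq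
    have h2 := hq.isSelfAdjoint.star_eq
    rw [Matrix.star_eq_conjTranspose] at h1 h2
    simp [IsSelfAdjoint, Matrix.star_eq_conjTranspose, Matrix.fromBlocks_conjTranspose, h1, h2]

theorem unitary_reindex [DecidableEq ι] [DecidableEq κ] {u : Matrix ι ι B}
    (hu : u ∈ unitary (Matrix ι ι B)) (e : ι ≃ κ) :
    Matrix.reindex e e u ∈ unitary (Matrix κ κ B) := by
  rw [Unitary.mem_iff, Matrix.star_eq_conjTranspose] at hu ⊢
  simp [hu.1, hu.2]

theorem unitary_blocks [DecidableEq ι] [DecidableEq κ] {u : Matrix ι ι B} {v : Matrix κ κ B}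
    (hu : u ∈ unitary (Matrix ι ι B)) (hv : v ∈ unitary (Matrix κ κ B)) :
    Matrix.fromBlocks u 0 0 v ∈ unitary (Matrix (ι ⊕ κ) (ι ⊕ κ) B) := by
  rw [Unitary.mem_iff, Matrix.star_eq_conjTranspose] at hu hv ⊢
  simp [Matrix.fromBlocks_conjTranspose, Matrix.fromBlocks_multiply, hu.1, hu.2, hv.1, hv.2,
    Matrix.fromBlocks_one]

end

variable (B : Type*) [CStarAlgebra B]

/-- The elementary moves between projections over `B`: renaming the index set, adding a zero block,
and norm-continuous homotopy through projections. -/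
inductive ProjMatrix.Rel : ProjMatrix B → ProjMatrix B → Prop
  | reindex {ι κ : Type} [Fintype ι] [Fintype κ] [DecidableEq ι] [DecidableEq κ] (e : ι ≃ κ)
      (p : Matrix ι ι B) (hp : IsStarProjection p) :
      Rel ⟨ι, p, hp⟩ ⟨κ, Matrix.reindex e e p, isStarProjection_reindex hp e⟩
  | stabilize {ι κ : Type} [Fintype ι] [Fintype κ] [DecidableEq ι] [DecidableEq κ]
      (p : Matrix ι ι B) (hp : IsStarProjection p) :
      Rel ⟨ι, p, hp⟩ ⟨ι ⊕ κ, Matrix.fromBlocks p 0 0 0, isStarProjection_blocks hp (.zero _)⟩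
  | homotopy {ι : Type} [Fintype ι] [DecidableEq ι] (p q : Matrix ι ι B) (hp : IsStarProjection p)
      (hq : IsStarProjection q) (h : JoinedIn {x : Matrix ι ι B | IsStarProjection x} p q) :
      Rel ⟨ι, p, hp⟩ ⟨ι, q, hq⟩

/-- The elementary moves between unitaries over `B`: renaming the index set, adding an identity
block, and norm-continuous homotopy through unitaries. -/
inductive UnitaryMatrix.Rel : UnitaryMatrix B → UnitaryMatrix B → Prop
  | reindex {ι κ : Type} [Fintype ι] [Fintype κ] [DecidableEq ι] [DecidableEq κ] (e : ι ≃ κ)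
      (u : Matrix ι ι B) (hu : u ∈ unitary (Matrix ι ι B)) :
      Rel ⟨ι, u, hu⟩ ⟨κ, Matrix.reindex e e u, unitary_reindex hu e⟩
  | stabilize {ι κ : Type} [Fintype ι] [Fintype κ] [DecidableEq ι] [DecidableEq κ]
      (u : Matrix ι ι B) (hu : u ∈ unitary (Matrix ι ι B)) :
      Rel ⟨ι, u, hu⟩ ⟨ι ⊕ κ, Matrix.fromBlocks u 0 0 1, unitary_blocks hu (one_mem _)⟩
  | homotopy {ι : Type} [Fintype ι] [DecidableEq ι] (u v : Matrix ι ι B)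
      (hu : u ∈ unitary (Matrix ι ι B)) (hv : v ∈ unitary (Matrix ι ι B))
      (h : JoinedIn (unitary (Matrix ι ι B) : Set (Matrix ι ι B)) u v) :
      Rel ⟨ι, u, hu⟩ ⟨ι, v, hv⟩

/-- The monoid `V(B)` of stable homotopy classes of projections in matrix algebras over `B`,
with the block sum as addition. -/
def V : Type _ := Quot (ProjMatrix.Rel B)

/-- The `K₁`-group of a unital C⋆-algebra: stable homotopy classes of unitaries in matrix algebras
over `B`, with the block sum as addition. -/
def UnitalK1 : Type _ := Quot (UnitaryMatrix.Rel B)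

variable {B}

/-- The class of a projection matrix in `V(B)`. -/
def V.mk {ι : Type} [Fintype ι] [DecidableEq ι] (p : Matrix ι ι B) (hp : IsStarProjection p) : V B :=
  Quot.mk _ ⟨ι, p, hp⟩

/-- The class of a unitary matrix in `K₁(B)`. -/
def UnitalK1.mk {ι : Type} [Fintype ι] [DecidableEq ι] (u : Matrix ι ι B)
    (hu : u ∈ unitary (Matrix ι ι B)) : UnitalK1 B :=
  Quot.mk _ ⟨ι, u, hu⟩

section V

variable {ι κ : Type} [Fintype ι] [Fintype κ] [DecidableEq ι] [DecidableEq κ]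

theorem V.mk_reindex (e : ι ≃ κ) (p : Matrix ι ι B) (hp : IsStarProjection p) :
    V.mk (Matrix.reindex e e p) (isStarProjection_reindex hp e) = V.mk p hp :=
  (Quot.sound (.reindex e p hp)).symm

theorem V.mk_eq_of_reindex (e : ι ≃ κ) {p : Matrix ι ι B} {hp : IsStarProjection p}
    {q : Matrix κ κ B} {hq : IsStarProjection q} (h : q = Matrix.reindex e e p) :
    V.mk p hp = V.mk q hq := by
  subst h; exact (V.mk_reindex e p hp).symm

theorem V.mk_stabilize (p : Matrix ι ι B) (hp : IsStarProjection p) :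
    V.mk (Matrix.fromBlocks p 0 0 (0 : Matrix κ κ B)) (isStarProjection_blocks hp (.zero _)) =
      V.mk p hp :=
  (Quot.sound (.stabilize p hp)).symm

theorem V.mk_homotopy {p q : Matrix ι ι B} (hp : IsStarProjection p) (hq : IsStarProjection q)
    (h : JoinedIn {x : Matrix ι ι B | IsStarProjection x} p q) : V.mk p hp = V.mk q hq :=
  Quot.sound (.homotopy p q hp hq h)

theorem joinedIn_map {X Y : Type*} [TopologicalSpace X] [TopologicalSpace Y] {S : Set X}
    {T : Set Y} {x y : X} (h : JoinedIn S x y) {f : X → Y} (hf : Continuous f)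
    (hST : ∀ z ∈ S, f z ∈ T) : JoinedIn T (f x) (f y) := by
  obtain ⟨γ, hγ⟩ := h
  exact ⟨γ.map hf, fun t => hST _ (hγ t)⟩

/-- Block sum of projections. -/
def ProjMatrix.add (P Q : ProjMatrix B) : ProjMatrix B :=
  ⟨P.ι ⊕ Q.ι, Matrix.fromBlocks P.mat 0 0 Q.mat, isStarProjection_blocks P.isProj Q.isProj⟩

theorem ProjMatrix.mk_add_comm (P Q : ProjMatrix B) :
    (Quot.mk _ (P.add Q) : V B) = Quot.mk _ (Q.add P) :=
  V.mk_eq_of_reindex (Equiv.sumComm _ _) (by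
    ext i j; rcases i with i | i <;> rcases j with j | j <;> simp [Matrix.fromBlocks])

theorem ProjMatrix.mk_add_congr_left (P Q R : ProjMatrix B) (h : ProjMatrix.Rel B P Q) :
    (Quot.mk _ (P.add R) : V B) = Quot.mk _ (Q.add R) := by
  cases h with
  | reindex e p hp =>
    exact V.mk_eq_of_reindex (Equiv.sumCongr e (Equiv.refl _)) (by
      ext i j; rcases i with i | i <;> rcases j with j | j <;>
        simp [Matrix.fromBlocks])
  | @stabilize ι κ _ _ _ _ p hp =>
    refine (V.mk_stabilize (κ := κ) (Matrix.fromBlocks p 0 0 R.mat)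
      (isStarProjection_blocks hp R.isProj)).symm.trans ?_
    refine V.mk_eq_of_reindex ((Equiv.sumAssoc _ _ _).trans <| (Equiv.sumCongr (Equiv.refl _)
      (Equiv.sumComm _ _)).trans (Equiv.sumAssoc _ _ _).symm) ?_
    ext i j
    rcases i with (i | i) | i <;> rcases j with (j | j) | j <;> simp [Matrix.fromBlocks]
  | homotopy p q hp hq h =>
    refine V.mk_homotopy _ _ (joinedIn_map h (f := fun x => Matrix.fromBlocks x 0 0 R.mat) ?_ ?_)
    · exact Continuous.matrix_fromBlocks continuous_id continuous_const continuous_const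
        continuous_const
    · exact fun z hz => isStarProjection_blocks hz R.isProj

instance : Add (V B) :=
  ⟨Quot.lift₂ (fun P Q => Quot.mk _ (P.add Q))
    (fun P Q R h => by
      rw [ProjMatrix.mk_add_comm P Q, ProjMatrix.mk_add_comm P R]
      exact ProjMatrix.mk_add_congr_left _ _ _ h)
    (fun P Q R h => ProjMatrix.mk_add_congr_left _ _ _ h)⟩

instance : Zero (V B) := ⟨V.mk (0 : Matrix Empty Empty B) (.zero _)⟩

theorem V.mk_add_mk (p : Matrix ι ι B) (hp : IsStarProjection p) (q : Matrix κ κ B)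
    (hq : IsStarProjection q) :
    V.mk p hp + V.mk q hq = V.mk (Matrix.fromBlocks p 0 0 q) (isStarProjection_blocks hp hq) :=
  rfl

theorem V.mk_zero : V.mk (0 : Matrix ι ι B) (.zero _) = 0 := by
  refine Eq.trans ?_ (V.mk_stabilize (κ := ι) (0 : Matrix Empty Empty B) (.zero _))
  refine V.mk_eq_of_reindex (Equiv.emptySum _ _).symm ?_
  ext i j; rcases i with i | i <;> rcases j with j | j <;> simp [Matrix.fromBlocks]

instance : AddCommMonoid (V B) where
  add_assoc a b c := by
    induction a using Quot.ind; induction b using Quot.ind; induction c using Quot.ind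
    refine V.mk_eq_of_reindex (Equiv.sumAssoc _ _ _) ?_
    ext i j
    rcases i with i | i | i <;> rcases j with j | j | j <;> rfl
  zero_add a := by
    induction a using Quot.ind
    refine V.mk_eq_of_reindex (Equiv.emptySum _ _) ?_
    ext i j; simp [Matrix.fromBlocks]
  add_zero a := by
    induction a using Quot.ind
    refine V.mk_eq_of_reindex (Equiv.sumEmpty _ _) ?_
    ext i j; simp [Matrix.fromBlocks]
  add_comm a b := by
    induction a using Quot.ind; induction b using Quot.ind
    exact ProjMatrix.mk_add_comm _ _
  nsmul := nsmulRec

end V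

section K1

variable {ι κ : Type} [Fintype ι] [Fintype κ] [DecidableEq ι] [DecidableEq κ]

theorem UnitalK1.mk_eq_of_reindex (e : ι ≃ κ) {u : Matrix ι ι B}
    {hu : u ∈ unitary (Matrix ι ι B)} {v : Matrix κ κ B} {hv : v ∈ unitary (Matrix κ κ B)}
    (h : v = Matrix.reindex e e u) : UnitalK1.mk u hu = UnitalK1.mk v hv := by
  subst h; exact Quot.sound (.reindex e u hu)

theorem UnitalK1.mk_stabilize (u : Matrix ι ι B) (hu : u ∈ unitary (Matrix ι ι B)) :
    UnitalK1.mk (Matrix.fromBlocks u 0 0 (1 : Matrix κ κ B)) (unitary_blocks hu (one_mem _)) =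
      UnitalK1.mk u hu :=
  (Quot.sound (.stabilize u hu)).symm

theorem UnitalK1.mk_homotopy {u v : Matrix ι ι B} (hu : u ∈ unitary (Matrix ι ι B))
    (hv : v ∈ unitary (Matrix ι ι B))
    (h : JoinedIn (unitary (Matrix ι ι B) : Set (Matrix ι ι B)) u v) :
    UnitalK1.mk u hu = UnitalK1.mk v hv :=
  Quot.sound (.homotopy u v hu hv h)

/-- Block sum of unitaries. -/
def UnitaryMatrix.add (P Q : UnitaryMatrix B) : UnitaryMatrix B :=
  ⟨P.ι ⊕ Q.ι, Matrix.fromBlocks P.mat 0 0 Q.mat, unitary_blocks P.isUnitary Q.isUnitary⟩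

/-- The adjoint of a unitary. -/
def UnitaryMatrix.neg (P : UnitaryMatrix B) : UnitaryMatrix B :=
  ⟨P.ι, star P.mat, Unitary.star_mem P.isUnitary⟩

theorem UnitaryMatrix.mk_add_comm (P Q : UnitaryMatrix B) :
    (Quot.mk _ (P.add Q) : UnitalK1 B) = Quot.mk _ (Q.add P) :=
  UnitalK1.mk_eq_of_reindex (Equiv.sumComm _ _) (by
    ext i j; rcases i with i | i <;> rcases j with j | j <;> simp [Matrix.fromBlocks])

theorem UnitaryMatrix.mk_add_congr_left (P Q R : UnitaryMatrix B) (h : UnitaryMatrix.Rel B P Q) :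
    (Quot.mk _ (P.add R) : UnitalK1 B) = Quot.mk _ (Q.add R) := by
  cases h with
  | reindex e u hu =>
    exact UnitalK1.mk_eq_of_reindex (Equiv.sumCongr e (Equiv.refl _)) (by
      ext i j; rcases i with i | i <;> rcases j with j | j <;>
        simp [Matrix.fromBlocks])
  | @stabilize ι κ _ _ _ _ u hu =>
    refine (UnitalK1.mk_stabilize (κ := κ) (Matrix.fromBlocks u 0 0 R.mat)
      (unitary_blocks hu R.isUnitary)).symm.trans ?_
    refine UnitalK1.mk_eq_of_reindex ((Equiv.sumAssoc _ _ _).trans <| (Equiv.sumCongr (Equiv.refl _)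
      (Equiv.sumComm _ _)).trans (Equiv.sumAssoc _ _ _).symm) ?_
    ext i j
    rcases i with (i | i) | i <;> rcases j with (j | j) | j <;> simp [Matrix.fromBlocks]
  | homotopy u v hu hv h =>
    refine UnitalK1.mk_homotopy _ _
      (joinedIn_map h (f := fun x => Matrix.fromBlocks x 0 0 R.mat) ?_ ?_)
    · exact Continuous.matrix_fromBlocks continuous_id continuous_const continuous_const
        continuous_const
    · exact fun z hz => unitary_blocks hz R.isUnitary

theorem UnitaryMatrix.mk_neg_congr (P Q : UnitaryMatrix B) (h : UnitaryMatrix.Rel B P Q) :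
    (Quot.mk _ P.neg : UnitalK1 B) = Quot.mk _ Q.neg := by
  cases h with
  | reindex e u hu =>
    exact UnitalK1.mk_eq_of_reindex e (by ext i j; simp [Matrix.star_apply])
  | @stabilize ι κ _ _ _ _ u hu =>
    refine (UnitalK1.mk_stabilize (κ := κ) (star u) (Unitary.star_mem hu)).symm.trans ?_
    refine UnitalK1.mk_eq_of_reindex (Equiv.refl _) ?_
    simp [Matrix.star_eq_conjTranspose, Matrix.fromBlocks_conjTranspose]
  | homotopy u v hu hv h =>
    exact UnitalK1.mk_homotopy _ _ (joinedIn_map h continuous_star fun z hz => Unitary.star_mem hz)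

instance : Add (UnitalK1 B) :=
  ⟨Quot.lift₂ (fun P Q => Quot.mk _ (P.add Q))
    (fun P Q R h => by
      rw [UnitaryMatrix.mk_add_comm P Q, UnitaryMatrix.mk_add_comm P R]
      exact UnitaryMatrix.mk_add_congr_left _ _ _ h)
    (fun P Q R h => UnitaryMatrix.mk_add_congr_left _ _ _ h)⟩

instance : Neg (UnitalK1 B) :=
  ⟨Quot.lift (fun P => Quot.mk _ P.neg) UnitaryMatrix.mk_neg_congr⟩

instance : Zero (UnitalK1 B) := ⟨UnitalK1.mk (1 : Matrix Empty Empty B) (one_mem _)⟩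

theorem UnitalK1.mk_add_mk (u : Matrix ι ι B) (hu : u ∈ unitary (Matrix ι ι B))
    (v : Matrix κ κ B) (hv : v ∈ unitary (Matrix κ κ B)) :
    UnitalK1.mk u hu + UnitalK1.mk v hv =
      UnitalK1.mk (Matrix.fromBlocks u 0 0 v) (unitary_blocks hu hv) :=
  rfl

theorem UnitalK1.mk_one : UnitalK1.mk (1 : Matrix ι ι B) (one_mem _) = 0 := by
  refine Eq.trans ?_ (UnitalK1.mk_stabilize (κ := ι) (1 : Matrix Empty Empty B) (one_mem _))
  refine UnitalK1.mk_eq_of_reindex (Equiv.emptySum _ _).symm ?_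
  ext i j
  rcases i with i | i <;> rcases j with j | j <;> first | exact i.elim | exact j.elim | skip
  rfl

/-- The unitary rotation matrix by the angle `t` in two blocks of equal size. -/
def rotation (ι : Type) [Fintype ι] [DecidableEq ι] (B : Type*) [CStarAlgebra B] (t : ℝ) :
    Matrix (ι ⊕ ι) (ι ⊕ ι) B :=
  Matrix.fromBlocks ((Real.cos t : ℂ) • 1) (-((Real.sin t : ℂ) • 1)) ((Real.sin t : ℂ) • 1)
    ((Real.cos t : ℂ) • 1)

theorem rotation_mem (t : ℝ) :
    rotation ι B t ∈ unitary (Matrix (ι ⊕ ι) (ι ⊕ ι) B) := by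
  have h : (Real.cos t : ℂ) * Real.cos t + (Real.sin t : ℂ) * Real.sin t = 1 := by
    have := Real.cos_sq_add_sin_sq t
    rw [pow_two, pow_two] at this
    exact_mod_cast this
  have h' : (Real.sin t : ℂ) * Real.sin t + (Real.cos t : ℂ) * Real.cos t = 1 := by
    rw [add_comm, h]
  have e1 : (starRingEnd ℂ) (Real.cos t : ℂ) = Real.cos t := Complex.conj_ofReal _
  have e2 : (starRingEnd ℂ) (Real.sin t : ℂ) = Real.sin t := Complex.conj_ofReal _
  rw [Unitary.mem_iff, Matrix.star_eq_conjTranspose, rotation, Matrix.fromBlocks_conjTranspose,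
    Matrix.fromBlocks_multiply, Matrix.fromBlocks_multiply, ← Matrix.fromBlocks_one]
  simp only [Matrix.conjTranspose_smul, Matrix.conjTranspose_neg, Matrix.conjTranspose_one,
    Complex.star_def, e1, e2, smul_mul_smul_comm, mul_one, neg_mul, mul_neg, neg_neg, ← add_smul,
    ← sub_eq_add_neg, h, h', one_smul]
  constructor <;> congr 1 <;> rw [mul_comm] <;> simp

theorem continuous_rotation : Continuous (rotation ι B) := by
  unfold rotation
  refine Continuous.matrix_fromBlocks ?_ ?_ ?_ ?_ <;> fun_prop

theorem UnitalK1.mk_neg_add (u : Matrix ι ι B) (hu : u ∈ unitary (Matrix ι ι B)) :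
    UnitalK1.mk (Matrix.fromBlocks (star u) 0 0 u) (unitary_blocks (Unitary.star_mem hu) hu) =
      0 := by
  rw [← UnitalK1.mk_one (ι := ι ⊕ ι)]
  refine UnitalK1.mk_homotopy _ _ ?_
  have hu' := hu
  rw [Unitary.mem_iff] at hu'
  refine JoinedIn.ofLine (f := fun t : ℝ => Matrix.fromBlocks (star u) 0 0 1 *
    rotation ι B (t * (Real.pi / 2)) * Matrix.fromBlocks 1 0 0 u *
      star (rotation ι B (t * (Real.pi / 2)))) ?_ ?_ ?_ ?_
  · have := (continuous_rotation (ι := ι) (B := B)).comp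
      (continuous_id.mul (continuous_const (y := Real.pi / 2)))
    exact (((continuous_const.mul this).mul continuous_const).mul
      (continuous_star.comp this)).continuousOn
  · simp [rotation, Matrix.fromBlocks_multiply, Matrix.star_eq_conjTranspose]
  · simp [rotation, Matrix.fromBlocks_multiply, Matrix.star_eq_conjTranspose,
      Matrix.fromBlocks_conjTranspose]
    rw [Matrix.star_eq_conjTranspose] at hu'
    rw [hu'.1, Matrix.fromBlocks_one]
  · rintro _ ⟨t, -, rfl⟩
    exact mul_mem (mul_mem (mul_mem (unitary_blocks (Unitary.star_mem hu) (one_mem _))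
      (rotation_mem _)) (unitary_blocks (one_mem _) hu)) (Unitary.star_mem (rotation_mem _))

instance : AddCommGroup (UnitalK1 B) where
  add_assoc a b c := by
    induction a using Quot.ind; induction b using Quot.ind; induction c using Quot.ind
    refine UnitalK1.mk_eq_of_reindex (Equiv.sumAssoc _ _ _) ?_
    ext i j
    rcases i with i | i | i <;> rcases j with j | j | j <;> rfl
  zero_add a := by
    induction a using Quot.ind
    refine UnitalK1.mk_eq_of_reindex (Equiv.emptySum _ _) ?_
    ext i j; simp [Matrix.fromBlocks]
  add_zero a := by
    induction a using Quot.ind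
    refine UnitalK1.mk_eq_of_reindex (Equiv.sumEmpty _ _) ?_
    ext i j; simp [Matrix.fromBlocks]
  add_comm a b := by
    induction a using Quot.ind; induction b using Quot.ind
    exact UnitaryMatrix.mk_add_comm _ _
  neg_add_cancel a := by
    induction a using Quot.ind with
    | mk P => exact UnitalK1.mk_neg_add P.mat P.isUnitary
  nsmul := nsmulRec
  zsmul := zsmulRec

end K1

section functoriality

variable {B' : Type*} [CStarAlgebra B'] {ι : Type} [Fintype ι] [DecidableEq ι]

theorem StarAlgHom.continuous_of_complex (φ : B →⋆ₐ[ℂ] B') : Continuous φ :=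
  AddMonoidHomClass.continuous_of_bound φ 1 fun x => by
    simpa using NonUnitalStarAlgHom.norm_apply_le φ x

theorem isStarProjection_map (φ : B →⋆ₐ[ℂ] B') {p : Matrix ι ι B} (hp : IsStarProjection p) :
    IsStarProjection (p.map φ) := by
  refine ⟨?_, ?_⟩
  · have := hp.isIdempotentElem.eq
    rw [IsIdempotentElem, ← Matrix.map_mul, this]
  · have := hp.isSelfAdjoint.star_eq
    rw [Matrix.star_eq_conjTranspose] at this
    rw [IsSelfAdjoint, Matrix.star_eq_conjTranspose,
      ← Matrix.conjTranspose_map φ (fun x => map_star φ x), this]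

/-- The monoid homomorphism `V(B) → V(B')` induced by a unital star homomorphism. -/
def V.map (φ : B →⋆ₐ[ℂ] B') : V B →+ V B' where
  toFun := Quot.lift (fun P => V.mk (P.mat.map φ) (isStarProjection_map φ P.isProj)) (by
    intro P Q h
    cases h with
    | reindex e p hp => exact V.mk_eq_of_reindex e (by ext i j; simp)
    | @stabilize ι κ _ _ _ _ p hp =>
      refine (V.mk_stabilize (κ := κ) (p.map φ) (isStarProjection_map φ hp)).symm.trans ?_
      refine V.mk_eq_of_reindex (Equiv.refl _) ?_
      ext i j
      rcases i with i | i <;> rcases j with j | j <;> simp [Matrix.fromBlocks]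
    | homotopy p q hp hq h =>
      refine V.mk_homotopy _ _ (joinedIn_map h (f := fun x => x.map φ) ?_
        fun z hz => isStarProjection_map φ hz)
      exact continuous_id.matrix_map (StarAlgHom.continuous_of_complex φ))
  map_zero' := V.mk_eq_of_reindex (Equiv.refl _) (by ext i; exact i.elim)
  map_add' a b := by
    induction a using Quot.ind; induction b using Quot.ind
    refine V.mk_eq_of_reindex (Equiv.refl _) ?_
    ext i j
    rcases i with i | i <;> rcases j with j | j <;>
      first | rfl | exact (map_zero φ).symm

end functoriality

/-- The `K₀`-group of a unital C⋆-algebra: formal differences of classes of projections. -/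
abbrev UnitalK0 (B : Type*) [CStarAlgebra B] : Type _ := Algebra.GrothendieckAddGroup (V B)

/-- Functoriality of `K₀` for unital star homomorphisms. -/
def UnitalK0.map {B' : Type*} [CStarAlgebra B'] (φ : B →⋆ₐ[ℂ] B') : UnitalK0 B →+ UnitalK0 B' :=
  Algebra.GrothendieckAddGroup.lift (Algebra.GrothendieckAddGroup.of.comp (V.map φ))

/-- The scalar part `A⁺ → ℂ` on the unitization `A⁺` of a C⋆-algebra `A`. -/
def scalarPart (A : Type*) [NonUnitalCStarAlgebra A] : Unitization ℂ A →⋆ₐ[ℂ] ℂ :=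
  { Unitization.fstHom ℂ A with map_star' := fun _ => rfl }

/-- The `K₀`-group of a not necessarily unital C⋆-algebra `A`: the kernel of the map
`K₀(A⁺) → K₀(ℂ)` induced by the scalar part. -/
def K0 (A : Type*) [NonUnitalCStarAlgebra A] : AddSubgroup (UnitalK0 (Unitization ℂ A)) :=
  (UnitalK0.map (scalarPart A)).ker

/-- The `K₁`-group of a not necessarily unital C⋆-algebra `A`: stable homotopy classes of unitaries
in matrix algebras over the unitization `A⁺`. -/
abbrev K1 (A : Type*) [NonUnitalCStarAlgebra A] : Type _ := UnitalK1 (Unitization ℂ A)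

section

variable {A : Type*} [NonUnitalCStarAlgebra A]

theorem isStarProjection_inr {p : A} (hp : IsStarProjection p) :
    IsStarProjection (Matrix.of fun _ _ : Unit => (p : Unitization ℂ A)) := by
  refine ⟨?_, ?_⟩
  · refine Matrix.ext fun i j => ?_
    simp [Matrix.mul_apply, ← Unitization.inr_mul, hp.isIdempotentElem.eq]
  · refine Matrix.ext fun i j => ?_
    simp [Matrix.star_apply, ← Unitization.inr_star, hp.isSelfAdjoint.star_eq]

/-- The class `[p] ∈ K₀(A)` of a projection `p ∈ A`. -/
def K0.ofProjection (p : A) (hp : IsStarProjection p) : K0 A :=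
  ⟨Algebra.GrothendieckAddGroup.of (V.mk _ (isStarProjection_inr hp)), by
    have : V.map (scalarPart A) (V.mk _ (isStarProjection_inr hp)) = 0 := by
      refine Eq.trans ?_ (V.mk_zero (ι := Unit))
      refine V.mk_eq_of_reindex (Equiv.refl _) ?_
      ext i j
      rfl
    rw [K0, AddMonoidHom.mem_ker, UnitalK0.map]
    rw [show ∀ (f : V (Unitization ℂ A) →+ UnitalK0 ℂ) x, Algebra.GrothendieckAddGroup.lift f
      (Algebra.GrothendieckAddGroup.of x) = f x from fun f x => DFunLike.congr_fun
        (Algebra.GrothendieckAddGroup.lift.symm_apply_apply f) x]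
    rw [AddMonoidHom.comp_apply, this, map_zero]⟩

end

section exponential

open scoped Nat

variable {B : Type*} [CStarAlgebra B] {ι κ : Type} [Fintype ι]
  [Fintype κ] [DecidableEq ι] [DecidableEq κ]

open scoped Matrix.Norms.Operator in
theorem matrix_completeSpace :
    @CompleteSpace (Matrix ι ι B) PseudoMetricSpace.toUniformSpace :=
  (inferInstance : CompleteSpace (ι → ι → B))

theorem matrix_exp_hasSum (x : Matrix ι ι B) :
    HasSum (fun n : ℕ => (n !⁻¹ : ℂ) • x ^ n) (NormedSpace.exp x) := by
  open scoped Matrix.Norms.Operator in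
  have := matrix_completeSpace (ι := ι) (B := B)
  exact NormedSpace.exp_series_hasSum_exp' x

theorem matrix_exp_continuous :
    Continuous (NormedSpace.exp : Matrix ι ι B → Matrix ι ι B) := by
  open scoped Matrix.Norms.Operator in
  have := matrix_completeSpace (ι := ι) (B := B)
  let _ : NormedAlgebra ℚ (Matrix ι ι B) := NormedAlgebra.restrictScalars ℚ ℂ _
  exact NormedSpace.exp_continuous

theorem matrix_exp_mem_unitary {x : Matrix ι ι B} (h : star x = -x) :
    NormedSpace.exp x ∈ unitary (Matrix ι ι B) := by
  have hs : star (NormedSpace.exp x) = NormedSpace.exp (-x) := by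
    rw [NormedSpace.star_exp, h]
  have hadd : ∀ y z : Matrix ι ι B, Commute y z →
      NormedSpace.exp (y + z) = NormedSpace.exp y * NormedSpace.exp z := by
    intro y z hyz
    let _ : NormedAlgebra ℚ B := NormedAlgebra.restrictScalars ℚ ℂ _
    exact Matrix.exp_add_of_commute y z hyz
  rw [Unitary.mem_iff, hs, ← hadd _ _ (Commute.refl x).neg_left,
    ← hadd _ _ (Commute.refl x).neg_right, neg_add_cancel, add_neg_cancel, NormedSpace.exp_zero]
  exact ⟨rfl, rfl⟩

/-- A continuous linear map compatible with powers commutes with the exponential. -/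
theorem matrix_exp_map {B' : Type*} [CStarAlgebra B'] (f : Matrix ι ι B →ₗ[ℂ] Matrix κ κ B')
    (hf : Continuous f) (x : Matrix ι ι B) (hx : ∀ n : ℕ, f (x ^ n) = f x ^ n) :
    f (NormedSpace.exp x) = NormedSpace.exp (f x) := by
  have h := (matrix_exp_hasSum x).map f hf
  refine h.unique ?_
  convert matrix_exp_hasSum (f x) using 2 with n
  simp [hx]

theorem matrix_exp_reindex (e : ι ≃ κ) (x : Matrix ι ι B) :
    NormedSpace.exp (Matrix.reindex e e x) = Matrix.reindex e e (NormedSpace.exp x) := by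
  refine (matrix_exp_map (Matrix.reindexAlgEquiv ℂ B e).toLinearMap ?_ x ?_).symm
  · exact continuous_id.matrix_submatrix _ _
  · intro n; exact map_pow (Matrix.reindexAlgEquiv ℂ B e) x n

theorem matrix_exp_blocks (x : Matrix ι ι B) (y : Matrix κ κ B) :
    NormedSpace.exp (Matrix.fromBlocks x 0 0 y) =
      Matrix.fromBlocks (NormedSpace.exp x) 0 0 (NormedSpace.exp y) := by
  have hpow : ∀ n : ℕ, Matrix.fromBlocks x 0 0 y ^ n = Matrix.fromBlocks (x ^ n) 0 0 (y ^ n) := by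
    intro n
    induction n with
    | zero => simp [Matrix.fromBlocks_one]
    | succ n ih => simp [pow_succ, ih, Matrix.fromBlocks_multiply]
  have h := (matrix_exp_hasSum x).prodMk (matrix_exp_hasSum y)
  have h2 := h.map (⟨⟨fun z => Matrix.fromBlocks z.1 0 0 z.2,
      by ext i j; rcases i with i | i <;> rcases j with j | j <;> simp⟩,
      fun a b => by simp [Matrix.fromBlocks_add]⟩ :
    Matrix ι ι B × Matrix κ κ B →+ Matrix (ι ⊕ κ) (ι ⊕ κ) B)
    (Continuous.matrix_fromBlocks continuous_fst continuous_const continuous_const continuous_snd)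
  refine (matrix_exp_hasSum _).unique ?_
  convert h2 using 1
  · ext1 n
    simp [hpow, Matrix.fromBlocks_smul]
  · rfl

theorem matrix_exp_idempotent (p : Matrix ι ι B) (hp : IsIdempotentElem p) :
    NormedSpace.exp ((2 * Real.pi * Complex.I : ℂ) • p) = 1 := by
  set c : ℂ := 2 * Real.pi * Complex.I with hc
  have h1 := matrix_exp_hasSum (c • p)
  have h2 : HasSum (fun n : ℕ => ((n !⁻¹ : ℂ) * c ^ n) • p) p := by
    have := (NormedSpace.exp_series_hasSum_exp' (𝕂 := ℂ) c).smul_const p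
    rw [← Complex.exp_eq_exp_ℂ, hc, Complex.exp_two_pi_mul_I, one_smul] at this
    simpa using this
  have h3 : HasSum (fun n : ℕ => if n = 0 then 1 - p else 0) (1 - p) := hasSum_ite_eq 0 (1 - p)
  have h4 := h2.add h3
  rw [add_sub_cancel] at h4
  refine h1.unique ?_
  convert h4 using 1
  ext1 n
  rcases n with _ | n
  · simp
  · simp [smul_pow, hp.pow_succ_eq, mul_smul]

end exponential
section MayerVietoris

theorem fst_sub' {A : Type*} [NonUnitalCStarAlgebra A] (x y : Unitization ℂ A) :
    (x - y).fst = x.fst - y.fst := rfl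

theorem snd_sub' {A : Type*} [NonUnitalCStarAlgebra A] (x y : Unitization ℂ A) :
    (x - y).snd = x.snd - y.snd := rfl

variable {𝔅 : Type*} [CStarAlgebra 𝔅]

/-- A C⋆-algebra `A` (inside an ambient C⋆-algebra) is decomposed into closed two-sided ideals
`I` and `J` with `A = I + J` and `I ∩ J = C`, the splitting `A = I + J` being given by a bounded
star-preserving linear map. -/
structure IsMayerVietoris (A I J C : NonUnitalStarSubalgebra ℂ 𝔅) : Prop where
  left_le : I ≤ A
  isClosed_left : IsClosed (I : Set 𝔅)
  isClosed_right : IsClosed (J : Set 𝔅)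
  mul_mem_left : ∀ a ∈ A, ∀ x ∈ I, a * x ∈ I
  mul_mem_right : ∀ a ∈ A, ∀ x ∈ J, a * x ∈ J
  mem_inter : ∀ x, x ∈ C ↔ x ∈ I ∧ x ∈ J
  exists_split : ∃ L : 𝔅 →L[ℂ] 𝔅, (∀ x, L (star x) = star (L x)) ∧
    ∀ a ∈ A, L a ∈ I ∧ a - L a ∈ J

namespace IsMayerVietoris

section

variable (A I J C : NonUnitalStarSubalgebra ℂ 𝔅) [IsClosed (A : Set 𝔅)] [IsClosed (C : Set 𝔅)]
variable {ι : Type} [Fintype ι] [DecidableEq ι]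

/-- `a` is a self-adjoint matrix over `I⁺` which agrees with `p` modulo `J`, i.e. `a` is a
self-adjoint lift to `I⁺` of the image of `p` under `A⁺ → (A / J)⁺ ≅ (I / C)⁺`. -/
def IsLift (p a : Matrix ι ι (Unitization ℂ A)) : Prop :=
  IsSelfAdjoint a ∧ ∀ i j, (a i j).fst = (p i j).fst ∧ ((a i j).snd : 𝔅) ∈ I ∧
    ((a i j).snd : 𝔅) - ((p i j).snd : 𝔅) ∈ J

/-- The matrix `u` over `C⁺` is `exp (2πi a)` for a self-adjoint lift `a` of `p`. -/
def IsExpLift (p : Matrix ι ι (Unitization ℂ A)) (u : Matrix ι ι (Unitization ℂ C)) : Prop :=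
  ∃ a, IsLift A I J p a ∧ ∀ i j,
    (u i j).fst = (NormedSpace.exp ((2 * Real.pi * Complex.I : ℂ) • a) i j).fst ∧
    ((u i j).snd : 𝔅) = ((NormedSpace.exp ((2 * Real.pi * Complex.I : ℂ) • a) i j).snd : 𝔅)

end

variable {A I J C : NonUnitalStarSubalgebra ℂ 𝔅} [IsClosed (A : Set 𝔅)] [IsClosed (C : Set 𝔅)]
variable {ι κ : Type} [Fintype ι] [DecidableEq ι] [Fintype κ] [DecidableEq κ]

theorem mul_mem_left' (h : IsMayerVietoris A I J C) {x a : 𝔅} (hx : x ∈ I) (ha : a ∈ A) :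
    x * a ∈ I := by
  have := star_mem (h.mul_mem_left _ (star_mem ha) _ (star_mem hx))
  simpa using this

theorem mul_mem_right' (h : IsMayerVietoris A I J C) {x a : 𝔅} (hx : x ∈ J) (ha : a ∈ A) :
    x * a ∈ J := by
  have := star_mem (h.mul_mem_right _ (star_mem ha) _ (star_mem hx))
  simpa using this

/-- The matrices over `A⁺` all of whose entries lie in the ideal `J`. -/
def idealMatrix (h : IsMayerVietoris A I J C) (ι : Type) [Fintype ι] [DecidableEq ι] :
    Submodule ℂ (Matrix ι ι (Unitization ℂ A)) where
  carrier := {m | ∀ i j, (m i j).fst = 0 ∧ ((m i j).snd : 𝔅) ∈ J}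
  add_mem' ha hb i j := ⟨by simp [(ha i j).1, (hb i j).1],
    by simpa using add_mem (ha i j).2 (hb i j).2⟩
  zero_mem' i j := ⟨rfl, by simp⟩
  smul_mem' c m hm i j := ⟨by simp [(hm i j).1], by simpa using SMulMemClass.smul_mem c (hm i j).2⟩

theorem isClosed_idealMatrix (h : IsMayerVietoris A I J C) :
    IsClosed (h.idealMatrix ι : Set (Matrix ι ι (Unitization ℂ A))) := by
  have : (h.idealMatrix ι : Set (Matrix ι ι (Unitization ℂ A))) =
      ⋂ i, ⋂ j, {m | (m i j).fst = 0 ∧ ((m i j).snd : 𝔅) ∈ J} := by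
    ext m; simp [idealMatrix]
  rw [this]
  refine isClosed_iInter fun i => isClosed_iInter fun j => IsClosed.inter ?_ ?_
  · exact isClosed_eq (Unitization.continuous_fst.comp (continuous_id.matrix_elem i j))
      continuous_const
  · exact h.isClosed_right.preimage (continuous_subtype_val.comp
      (Unitization.continuous_snd.comp (continuous_id.matrix_elem i j)))

theorem idealMatrix_mul_left (h : IsMayerVietoris A I J C) (x : Matrix ι ι (Unitization ℂ A))
    {m : Matrix ι ι (Unitization ℂ A)} (hm : m ∈ h.idealMatrix ι) : x * m ∈ h.idealMatrix ι := by
  intro i j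
  rw [Matrix.mul_apply]
  refine Finset.sum_induction _
    (fun y : Unitization ℂ A => y.fst = 0 ∧ (y.snd : 𝔅) ∈ J) ?_ ?_ ?_
  · rintro a b ⟨h1, h2⟩ ⟨h3, h4⟩
    exact ⟨by simp [h1, h3], by simpa using add_mem h2 h4⟩
  · exact ⟨rfl, by simp⟩
  · intro k _
    obtain ⟨h1, h2⟩ := hm k j
    refine ⟨by simp [h1], ?_⟩
    simp only [Unitization.snd_mul, h1, zero_smul, add_zero]
    exact add_mem (SMulMemClass.smul_mem (s := J) _ h2) (h.mul_mem_right _ (x i k).snd.2 _ h2)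

theorem idealMatrix_mul_right (h : IsMayerVietoris A I J C) (x : Matrix ι ι (Unitization ℂ A))
    {m : Matrix ι ι (Unitization ℂ A)} (hm : m ∈ h.idealMatrix ι) : m * x ∈ h.idealMatrix ι := by
  intro i j
  rw [Matrix.mul_apply]
  refine Finset.sum_induction _
    (fun y : Unitization ℂ A => y.fst = 0 ∧ (y.snd : 𝔅) ∈ J) ?_ ?_ ?_
  · rintro a b ⟨h1, h2⟩ ⟨h3, h4⟩
    exact ⟨by simp [h1, h3], by simpa using add_mem h2 h4⟩
  · exact ⟨rfl, by simp⟩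
  · intro k _
    obtain ⟨h1, h2⟩ := hm i k
    refine ⟨by simp [h1], ?_⟩
    simp only [Unitization.snd_mul, h1, zero_smul, zero_add]
    exact add_mem (SMulMemClass.smul_mem (s := J) _ h2) (h.mul_mem_right' h2 (x k j).snd.2)

/-- The matrices over `A⁺` which have entries in `I⁺`. -/
def leftMatrix (h : IsMayerVietoris A I J C) (ι : Type) [Fintype ι] [DecidableEq ι] :
    Subalgebra ℂ (Matrix ι ι (Unitization ℂ A)) where
  carrier := {m | ∀ i j, ((m i j).snd : 𝔅) ∈ I}
  add_mem' ha hb i j := by simpa using add_mem (ha i j) (hb i j)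
  mul_mem' := by
    intro x m hx hm i j
    rw [Matrix.mul_apply]
    refine Finset.sum_induction _ (fun y : Unitization ℂ A => (y.snd : 𝔅) ∈ I) ?_ ?_ ?_
    · intro a b h2 h4
      simpa using add_mem h2 h4
    · simp
    · intro k _
      simp only [Unitization.snd_mul]
      exact add_mem (add_mem (SMulMemClass.smul_mem (s := I) _ (hm k j))
        (SMulMemClass.smul_mem (s := I) _ (hx i k))) (mul_mem (hx i k) (hm k j))
  algebraMap_mem' r i j := by
    rw [Matrix.algebraMap_matrix_apply]
    split_ifs
    · exact zero_mem I
    · exact zero_mem I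

theorem isClosed_leftMatrix (h : IsMayerVietoris A I J C) :
    IsClosed (h.leftMatrix ι : Set (Matrix ι ι (Unitization ℂ A))) := by
  have : (h.leftMatrix ι : Set (Matrix ι ι (Unitization ℂ A))) =
      ⋂ i, ⋂ j, {m | ((m i j).snd : 𝔅) ∈ I} := by
    ext m; simp [leftMatrix]
  rw [this]
  refine isClosed_iInter fun i => isClosed_iInter fun j => ?_
  exact h.isClosed_left.preimage (continuous_subtype_val.comp
      (Unitization.continuous_snd.comp (continuous_id.matrix_elem i j)))

theorem isLift_iff (h : IsMayerVietoris A I J C) {p a : Matrix ι ι (Unitization ℂ A)} :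
    IsLift A I J p a ↔ IsSelfAdjoint a ∧ a ∈ h.leftMatrix ι ∧ a - p ∈ h.idealMatrix ι := by
  constructor
  · rintro ⟨h1, h2⟩
    exact ⟨h1, fun i j => (h2 i j).2.1, fun i j =>
      ⟨sub_eq_zero.2 (h2 i j).1, (h2 i j).2.2⟩⟩
  · rintro ⟨h1, h2, h3⟩
    exact ⟨h1, fun i j => ⟨sub_eq_zero.1 (h3 i j).1, h2 i j, (h3 i j).2⟩⟩

/-- For a lift `a` of a projection, `exp (2πi a)` has entries in `C⁺`. -/
theorem exp_lift_mem (h : IsMayerVietoris A I J C) {p a : Matrix ι ι (Unitization ℂ A)}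
    (hp : IsStarProjection p) (ha : IsLift A I J p a) (i j : ι) :
    ((NormedSpace.exp ((2 * Real.pi * Complex.I : ℂ) • a) i j).snd : 𝔅) ∈ C := by
  set c : ℂ := 2 * Real.pi * Complex.I with hc
  rw [h.mem_inter]
  constructor
  · have hmem : a ∈ h.leftMatrix ι := fun i j => (ha.2 i j).2.1
    have hs := matrix_exp_hasSum (c • a)
    have : NormedSpace.exp (c • a) ∈ h.leftMatrix ι := by
      rw [← hs.tsum_eq]
      exact tsum_mem h.isClosed_leftMatrix fun n =>
        Subalgebra.smul_mem _ (pow_mem (Subalgebra.smul_mem _ hmem c) n) _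
    exact this i j
  · have hsub : a - p ∈ h.idealMatrix ι := fun i j =>
      ⟨by simp [fst_sub', (ha.2 i j).1], by simpa [snd_sub'] using (ha.2 i j).2.2⟩
    have hpow : ∀ n : ℕ, a ^ n - p ^ n ∈ h.idealMatrix ι := by
      intro n
      induction n with
      | zero => simp
      | succ n ih =>
        have : a ^ (n + 1) - p ^ (n + 1) = a ^ n * (a - p) + (a ^ n - p ^ n) * p := by
          simp only [pow_succ]; noncomm_ring
        rw [this]
        exact add_mem (h.idealMatrix_mul_left _ hsub) (h.idealMatrix_mul_right _ ih)
    have hs := (matrix_exp_hasSum (c • a)).sub (matrix_exp_hasSum (c • p))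
    rw [matrix_exp_idempotent p hp.isIdempotentElem] at hs
    have hmem : NormedSpace.exp (c • a) - 1 ∈ h.idealMatrix ι := by
      rw [← hs.tsum_eq]
      refine tsum_mem h.isClosed_idealMatrix fun n => ?_
      rw [← smul_sub, smul_pow, smul_pow, ← smul_sub]
      exact Submodule.smul_mem _ _ (Submodule.smul_mem _ _ (hpow n))
    have := (hmem i j).2
    by_cases hij : i = j
    · subst hij; simpa [snd_sub'] using this
    · simpa [snd_sub', Matrix.one_apply, hij] using this

/-- The matrix over `C⁺` underlying a matrix over `A⁺` with entries in `C⁺`. -/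
def descend (x : Matrix ι ι (Unitization ℂ A)) (hx : ∀ i j, ((x i j).snd : 𝔅) ∈ C) :
    Matrix ι ι (Unitization ℂ C) :=
  Matrix.of fun i j => Unitization.inl (x i j).fst + Unitization.inr ⟨_, hx i j⟩

theorem inter_le (h : IsMayerVietoris A I J C) : C ≤ A :=
  fun x hx => h.left_le ((h.mem_inter x).1 hx).1

theorem map_descend (h : IsMayerVietoris A I J C) (x : Matrix ι ι (Unitization ℂ A))
    (hx : ∀ i j, ((x i j).snd : 𝔅) ∈ C) :
    (descend x hx).map (Unitization.starMap (NonUnitalStarSubalgebra.inclusion h.inter_le)) = x := by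
  refine Matrix.ext fun i j => ?_
  simp only [descend, Matrix.map_apply, Matrix.of_apply, map_add, Unitization.starMap_inl,
    Unitization.starMap_inr]
  exact Unitization.ext (by simp [Unitization.algebraMap_eq_inl])
    (by simp [Unitization.algebraMap_eq_inl])

theorem descend_mem_unitary (h : IsMayerVietoris A I J C) (x : Matrix ι ι (Unitization ℂ A))
    (hx : ∀ i j, ((x i j).snd : 𝔅) ∈ C) (hu : x ∈ unitary (Matrix ι ι (Unitization ℂ A))) :
    descend x hx ∈ unitary (Matrix ι ι (Unitization ℂ C)) := by
  set φ := Unitization.starMap (R := ℂ) (NonUnitalStarSubalgebra.inclusion h.inter_le) with hφ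
  have hinj : Function.Injective φ :=
    Unitization.starMap_injective (NonUnitalStarSubalgebra.inclusion_injective h.inter_le)
  have hmap : (descend x hx).map φ = x := h.map_descend x hx
  have hstar : (star (descend x hx)).map φ = star x := by
    rw [Matrix.star_eq_conjTranspose, Matrix.conjTranspose_map φ (fun y => map_star φ y), hmap,
      Matrix.star_eq_conjTranspose]
  have hone : (1 : Matrix ι ι (Unitization ℂ C)).map φ = 1 :=
    Matrix.map_one φ (map_zero φ) (map_one φ)
  rw [Unitary.mem_iff] at hu ⊢
  constructor
  · refine Matrix.map_injective hinj ?_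
    change Matrix.map _ φ = Matrix.map _ φ
    rw [hone, Matrix.map_mul, hstar, hmap, hu.1]
  · refine Matrix.map_injective hinj ?_
    change Matrix.map _ φ = Matrix.map _ φ
    rw [hone, Matrix.map_mul, hstar, hmap, hu.2]

theorem star_two_pi_smul {a : Matrix ι ι (Unitization ℂ A)} (ha : IsSelfAdjoint a) :
    star ((2 * Real.pi * Complex.I : ℂ) • a) = -((2 * Real.pi * Complex.I : ℂ) • a) := by
  rw [star_smul, ha.star_eq, ← neg_smul]
  congr 1
  simp

/-- The self-adjoint lift of a matrix over `A⁺` given by a bounded linear splitting. -/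
def splitMatrix (h : IsMayerVietoris A I J C) (L : 𝔅 →L[ℂ] 𝔅)
    (hL : ∀ a ∈ A, L a ∈ I ∧ a - L a ∈ J) (p : Matrix ι ι (Unitization ℂ A)) :
    Matrix ι ι (Unitization ℂ A) :=
  Matrix.of fun i j => Unitization.inl (p i j).fst +
    Unitization.inr ⟨L (p i j).snd, h.left_le (hL _ (p i j).snd.2).1⟩

theorem isLift_splitMatrix (h : IsMayerVietoris A I J C) (L : 𝔅 →L[ℂ] 𝔅)
    (hL : ∀ a ∈ A, L a ∈ I ∧ a - L a ∈ J) (hs : ∀ x, L (star x) = star (L x))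
    {p : Matrix ι ι (Unitization ℂ A)} (hp : IsStarProjection p) :
    IsLift A I J p (h.splitMatrix L hL p) := by
  refine ⟨Matrix.ext fun i j => ?_, fun i j => ⟨by simp [splitMatrix], ?_, ?_⟩⟩
  · have hij : star (p j i) = p i j := by
      have := congrFun (congrFun hp.isSelfAdjoint.star_eq i) j
      rwa [Matrix.star_apply] at this
    simp only [splitMatrix, Matrix.star_apply, Matrix.of_apply]
    refine Unitization.ext ?_ (Subtype.ext ?_)
    · have := congrArg (fun z : Unitization ℂ A => z.fst) hij
      simpa using this
    · have := congrArg (fun z : Unitization ℂ A => (z.snd : 𝔅)) hij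
      simpa [← hs] using congrArg L this
  · simpa [splitMatrix] using (hL _ (p i j).snd.2).1
  · have := neg_mem (hL _ (p i j).snd.2).2
    simpa [splitMatrix] using this

theorem continuous_splitMatrix (h : IsMayerVietoris A I J C) (L : 𝔅 →L[ℂ] 𝔅)
    (hL : ∀ a ∈ A, L a ∈ I ∧ a - L a ∈ J) :
    Continuous (h.splitMatrix L hL : Matrix ι ι (Unitization ℂ A) → _) := by
  refine continuous_matrix fun i j => ?_
  refine Continuous.add ?_ ?_
  · exact (Unitization.uniformEquivProd (𝕜 := ℂ) (A := A)).symm.continuous.comp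
      ((Unitization.continuous_fst.comp (continuous_id.matrix_elem i j)).prodMk
        (continuous_const (y := (0 : A))))
  · exact Unitization.continuous_inr.comp (Continuous.subtype_mk (L.continuous.comp
      (continuous_subtype_val.comp
        (Unitization.continuous_snd.comp (continuous_id.matrix_elem i j)))) _)

theorem continuous_descend {T : Type*} [TopologicalSpace T]
    {f : T → Matrix ι ι (Unitization ℂ A)} (hf : Continuous f)
    (hx : ∀ t i j, ((f t i j).snd : 𝔅) ∈ C) :
    Continuous fun t => descend (f t) (hx t) := by
  refine continuous_matrix fun i j => ?_
  refine Continuous.add ?_ ?_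
  · exact (Unitization.uniformEquivProd (𝕜 := ℂ) (A := C)).symm.continuous.comp
      ((Unitization.continuous_fst.comp (hf.matrix_elem i j)).prodMk
        (continuous_const (y := (0 : C))))
  · exact Unitization.continuous_inr.comp (Continuous.subtype_mk
      (continuous_subtype_val.comp (Unitization.continuous_snd.comp (hf.matrix_elem i j))) _)

theorem eq_descend {x : Matrix ι ι (Unitization ℂ A)} {hx : ∀ i j, ((x i j).snd : 𝔅) ∈ C}
    {u : Matrix ι ι (Unitization ℂ C)}
    (hu : ∀ i j, (u i j).fst = (x i j).fst ∧ ((u i j).snd : 𝔅) = ((x i j).snd : 𝔅)) :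
    descend x hx = u := by
  refine Matrix.ext fun i j => Unitization.ext ?_ (Subtype.ext ?_)
  · simp [descend, (hu i j).1]
  · simp [descend, (hu i j).2]

/-- A norm-continuous path of lifts of a path of projections gives a homotopy of unitaries. -/
theorem joinedIn_of_isExpLift (h : IsMayerVietoris A I J C)
    {p q : Matrix ι ι (Unitization ℂ A)} (hp : IsStarProjection p) (hq : IsStarProjection q)
    (hpq : JoinedIn {x : Matrix ι ι (Unitization ℂ A) | IsStarProjection x} p q)
    {u v : Matrix ι ι (Unitization ℂ C)} (hu : IsExpLift A I J C p u)
    (hv : IsExpLift A I J C q v) :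
    JoinedIn (unitary (Matrix ι ι (Unitization ℂ C)) : Set (Matrix ι ι (Unitization ℂ C))) u v := by
  obtain ⟨γ, hγ⟩ := hpq
  obtain ⟨a, ha, hau⟩ := hu
  obtain ⟨b, hb, hbv⟩ := hv
  obtain ⟨L, hs, hL⟩ := h.exists_split
  let c : ℂ := 2 * Real.pi * Complex.I
  let S : Matrix ι ι (Unitization ℂ A) → Matrix ι ι (Unitization ℂ A) := h.splitMatrix L hL
  have hS : ∀ x, IsStarProjection x → IsLift A I J x (S x) :=
    fun x hx => h.isLift_splitMatrix L hL hs hx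
  let f : unitInterval → Matrix ι ι (Unitization ℂ A) := fun t =>
    S (γ t) + ((1 - (t : ℝ) : ℝ) : ℂ) • (a - S p) + ((t : ℝ) : ℂ) • (b - S q)
  have hf : Continuous f := by
    have h1 : Continuous fun t => S (γ t) := (h.continuous_splitMatrix L hL).comp γ.continuous
    have h2 : Continuous fun t : unitInterval => ((1 - (t : ℝ) : ℝ) : ℂ) :=
      Complex.continuous_ofReal.comp (continuous_const.sub continuous_subtype_val)
    have h3 : Continuous fun t : unitInterval => ((t : ℝ) : ℂ) :=
      Complex.continuous_ofReal.comp continuous_subtype_val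
    exact (h1.add (h2.smul continuous_const)).add (h3.smul continuous_const)
  have hlift : ∀ t, IsLift A I J (γ t) (f t) := by
    intro t
    have h0 := h.isLift_iff.1 (hS _ (hγ t))
    have h1 := h.isLift_iff.1 (hS _ hp)
    have h2 := h.isLift_iff.1 (hS _ hq)
    have ha' := h.isLift_iff.1 ha
    have hb' := h.isLift_iff.1 hb
    refine h.isLift_iff.2 ⟨?_, ?_, ?_⟩
    · have e1 : IsSelfAdjoint (((1 - (t : ℝ) : ℝ) : ℂ)) := Complex.conj_ofReal _
      have e2 : IsSelfAdjoint (((t : ℝ) : ℂ)) := Complex.conj_ofReal _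
      exact (h0.1.add (e1.smul (ha'.1.sub h1.1))).add (e2.smul (hb'.1.sub h2.1))
    · exact add_mem (add_mem h0.2.1 (Subalgebra.smul_mem _ (sub_mem ha'.2.1 h1.2.1) _))
        (Subalgebra.smul_mem _ (sub_mem hb'.2.1 h2.2.1) _)
    · have := add_mem (add_mem h0.2.2 (Submodule.smul_mem _ ((1 - (t : ℝ) : ℝ) : ℂ)
        (sub_mem ha'.2.2 h1.2.2))) (Submodule.smul_mem _ ((t : ℝ) : ℂ) (sub_mem hb'.2.2 h2.2.2))
      rw [sub_sub_sub_cancel_right, sub_sub_sub_cancel_right] at this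
      have e : f t - γ t = S (γ t) - γ t + ((1 - (t : ℝ) : ℝ) : ℂ) • (a - S p) +
          ((t : ℝ) : ℂ) • (b - S q) := by
        simp only [f]; abel
      rw [e]; exact this
  have hcf : Continuous fun t => c • f t := (continuous_const (y := c)).smul hf
  have hexp : Continuous fun t => NormedSpace.exp (c • f t) :=
    (matrix_exp_continuous (B := Unitization ℂ A) (ι := ι)).comp hcf
  have hmem : ∀ t i j, ((NormedSpace.exp (c • f t) i j).snd : 𝔅) ∈ C :=
    fun t => h.exp_lift_mem (hγ t) (hlift t)
  have hf0 : f 0 = a := by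
    have e : ((1 - ((0 : unitInterval) : ℝ) : ℝ) : ℂ) = 1 := by simp
    have e' : (((0 : unitInterval) : ℝ) : ℂ) = 0 := by simp
    change S (γ 0) + _ • (a - S p) + _ • (b - S q) = a
    rw [γ.source, e, e', one_smul, zero_smul, add_zero, add_sub_cancel]
  have hf1 : f 1 = b := by
    have e : ((1 - ((1 : unitInterval) : ℝ) : ℝ) : ℂ) = 0 := by simp
    have e' : (((1 : unitInterval) : ℝ) : ℂ) = 1 := by simp
    change S (γ 1) + _ • (a - S p) + _ • (b - S q) = b
    rw [γ.target, e, e', one_smul, zero_smul, add_zero, add_sub_cancel]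
  refine ⟨⟨⟨fun t => descend (NormedSpace.exp (c • f t)) (hmem t), ?_⟩, ?_, ?_⟩, ?_⟩
  · exact continuous_descend hexp hmem
  · refine eq_descend fun i j => ?_
    rw [hf0]; exact hau i j
  · refine eq_descend fun i j => ?_
    rw [hf1]; exact hbv i j
  · intro t
    exact h.descend_mem_unitary _ _ (matrix_exp_mem_unitary (star_two_pi_smul (hlift t).1))

theorem exists_isExpLift (h : IsMayerVietoris A I J C) {p : Matrix ι ι (Unitization ℂ A)}
    (hp : IsStarProjection p) :
    ∃ u ∈ unitary (Matrix ι ι (Unitization ℂ C)), IsExpLift A I J C p u := by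
  obtain ⟨L, hs, hL⟩ := h.exists_split
  have hl := h.isLift_splitMatrix L hL hs hp
  exact ⟨descend _ (h.exp_lift_mem hp hl),
    h.descend_mem_unitary _ _ (matrix_exp_mem_unitary (star_two_pi_smul hl.1)),
    _, hl, fun i j => ⟨by simp [descend], by simp [descend]⟩⟩

/-- The class of `exp (2πi a)` in `K₁(C)`, where `a` is any self-adjoint lift of the
projection `p`. -/
def expClass (h : IsMayerVietoris A I J C) (p : Matrix ι ι (Unitization ℂ A))
    (hp : IsStarProjection p) : K1 C :=
  UnitalK1.mk (h.exists_isExpLift hp).choose (h.exists_isExpLift hp).choose_spec.1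

theorem expClass_eq (h : IsMayerVietoris A I J C) {p : Matrix ι ι (Unitization ℂ A)}
    (hp : IsStarProjection p) {u : Matrix ι ι (Unitization ℂ C)}
    (hu : u ∈ unitary (Matrix ι ι (Unitization ℂ C))) (hpu : IsExpLift A I J C p u) :
    h.expClass p hp = UnitalK1.mk u hu :=
  UnitalK1.mk_homotopy _ _ (h.joinedIn_of_isExpLift hp hp (JoinedIn.refl hp)
    (h.exists_isExpLift hp).choose_spec.2 hpu)

theorem IsLift.reindex {p a : Matrix ι ι (Unitization ℂ A)} (ha : IsLift A I J p a) (e : ι ≃ κ) :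
    IsLift A I J (Matrix.reindex e e p) (Matrix.reindex e e a) := by
  refine ⟨?_, fun i j => ha.2 _ _⟩
  have := ha.1.star_eq
  rw [Matrix.star_eq_conjTranspose] at this
  simp [IsSelfAdjoint, Matrix.star_eq_conjTranspose, this]

theorem IsLift.blocks {p a : Matrix ι ι (Unitization ℂ A)} (ha : IsLift A I J p a)
    {q b : Matrix κ κ (Unitization ℂ A)} (hb : IsLift A I J q b) :
    IsLift A I J (Matrix.fromBlocks p 0 0 q) (Matrix.fromBlocks a 0 0 b) := by
  refine ⟨?_, fun i j => ?_⟩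
  · have h1 := ha.1.star_eq
    have h2 := hb.1.star_eq
    rw [Matrix.star_eq_conjTranspose] at h1 h2
    simp [IsSelfAdjoint, Matrix.star_eq_conjTranspose, Matrix.fromBlocks_conjTranspose, h1, h2]
  · rcases i with i | i <;> rcases j with j | j
    · exact ha.2 i j
    · simp
    · simp
    · exact hb.2 i j

theorem IsExpLift.reindex {p : Matrix ι ι (Unitization ℂ A)} {u : Matrix ι ι (Unitization ℂ C)}
    (hu : IsExpLift A I J C p u) (e : ι ≃ κ) :
    IsExpLift A I J C (Matrix.reindex e e p) (Matrix.reindex e e u) := by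
  obtain ⟨a, ha, hau⟩ := hu
  refine ⟨_, ha.reindex e, fun i j => ?_⟩
  have : (2 * Real.pi * Complex.I : ℂ) • Matrix.reindex e e a =
      Matrix.reindex e e ((2 * Real.pi * Complex.I : ℂ) • a) := rfl
  rw [this, matrix_exp_reindex]
  exact hau _ _

theorem IsExpLift.blocks {p : Matrix ι ι (Unitization ℂ A)} {u : Matrix ι ι (Unitization ℂ C)}
    (hu : IsExpLift A I J C p u) {q : Matrix κ κ (Unitization ℂ A)}
    {v : Matrix κ κ (Unitization ℂ C)} (hv : IsExpLift A I J C q v) :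
    IsExpLift A I J C (Matrix.fromBlocks p 0 0 q) (Matrix.fromBlocks u 0 0 v) := by
  obtain ⟨a, ha, hau⟩ := hu
  obtain ⟨b, hb, hbv⟩ := hv
  refine ⟨_, ha.blocks hb, fun i j => ?_⟩
  rw [Matrix.fromBlocks_smul, smul_zero, smul_zero, matrix_exp_blocks]
  rcases i with i | i <;> rcases j with j | j
  · exact hau i j
  · simp
  · simp
  · exact hbv i j

theorem isExpLift_zero : IsExpLift A I J C (0 : Matrix ι ι (Unitization ℂ A)) 1 := by
  refine ⟨0, ⟨.zero _, fun i j => by simp⟩, fun i j => ?_⟩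
  rw [smul_zero, NormedSpace.exp_zero]
  by_cases hij : i = j
  · subst hij; simp
  · simp [hij]

/-- The homomorphism `V(A⁺) → K₁(C)` sending the class of a projection `p` to the class of
`exp (2πi a)`, for `a` a self-adjoint lift of `p`. -/
def expV (h : IsMayerVietoris A I J C) : V (Unitization ℂ A) →+ K1 C where
  toFun := Quot.lift (fun P => h.expClass P.mat P.isProj) (by
    intro P Q hPQ
    cases hPQ with
    | reindex e p hp =>
      obtain ⟨u, hu, hpu⟩ := h.exists_isExpLift hp
      change h.expClass p hp = h.expClass _ (isStarProjection_reindex hp e)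
      rw [h.expClass_eq hp hu hpu, h.expClass_eq _ (unitary_reindex hu e) (hpu.reindex e)]
      exact UnitalK1.mk_eq_of_reindex e rfl
    | @stabilize ι κ _ _ _ _ p hp =>
      obtain ⟨u, hu, hpu⟩ := h.exists_isExpLift hp
      change h.expClass p hp = h.expClass _ (isStarProjection_blocks hp (.zero _))
      rw [h.expClass_eq hp hu hpu, h.expClass_eq (ι := ι ⊕ κ) _ (unitary_blocks hu (one_mem _))
        (hpu.blocks isExpLift_zero)]
      exact (UnitalK1.mk_stabilize u hu).symm
    | homotopy p q hp hq hpq =>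
      obtain ⟨u, hu, hpu⟩ := h.exists_isExpLift hp
      obtain ⟨v, hv, hqv⟩ := h.exists_isExpLift hq
      change h.expClass p hp = h.expClass q hq
      rw [h.expClass_eq hp hu hpu, h.expClass_eq hq hv hqv]
      exact UnitalK1.mk_homotopy _ _ (h.joinedIn_of_isExpLift hp hq hpq hpu hqv))
  map_zero' := by
    refine (h.expClass_eq (ι := Empty) (.zero _) (one_mem _) isExpLift_zero).trans ?_
    exact UnitalK1.mk_one
  map_add' x y := by
    induction x using Quot.ind with
    | mk P =>
    induction y using Quot.ind with
    | mk Q =>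
      obtain ⟨u, hu, hpu⟩ := h.exists_isExpLift P.isProj
      obtain ⟨v, hv, hqv⟩ := h.exists_isExpLift Q.isProj
      change h.expClass _ (isStarProjection_blocks P.isProj Q.isProj) =
        h.expClass P.mat P.isProj + h.expClass Q.mat Q.isProj
      rw [h.expClass_eq P.isProj hu hpu, h.expClass_eq Q.isProj hv hqv,
        h.expClass_eq (ι := P.ι ⊕ Q.ι) _ (unitary_blocks hu hv) (hpu.blocks hqv)]
      rfl

/-- The Mayer–Vietoris boundary map `∂ : K₀(A) → K₁(I ∩ J)`, i.e. the composition
`K₀(A) → K₀(A / J) ≅ K₀(I / (I ∩ J)) → K₁(I ∩ J)` whose last arrow is the exponential map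
`[q] ↦ [exp (2πi a)]`, `a` a self-adjoint lift of the projection `q`. -/
def boundary (h : IsMayerVietoris A I J C) : K0 A →+ K1 C :=
  (Algebra.GrothendieckAddGroup.lift h.expV).comp (K0 A).subtype

end IsMayerVietoris

end MayerVietoris

end KTheory

namespace Coarse

open scoped ZeroAtInfty

section XModule

variable (X : Type*) [MetricSpace X]
variable (ℋ : Type*) [NormedAddCommGroup ℋ] [InnerProductSpace ℂ ℋ] [CompleteSpace ℋ]

/-- An `X`-module structure on the Hilbert space `ℋ`: a (nondegenerate) action of `C₀(X)`. -/
structure XModule where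
  rep : C₀(X, ℂ) →⋆ₙₐ[ℂ] (ℋ →L[ℂ] ℋ)
  nondegenerate : (Submodule.span ℂ {w : ℋ | ∃ f v, rep f v = w}).topologicalClosure = ⊤

end XModule

variable {X : Type*} [MetricSpace X]
variable {ℋ : Type*} [NormedAddCommGroup ℋ] [InnerProductSpace ℂ ℋ] [CompleteSpace ℋ]

namespace XModule

variable (M : XModule X ℋ)

/-- The module is ample if only the zero function acts as a compact operator. -/
def IsAmple : Prop := ∀ f : C₀(X, ℂ), IsCompactOperator (M.rep f) → f = 0

/-- For `U` open, the range of the spectral projection `χ_U`: the closed span of the ranges of all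
`f ∈ C₀(X)` vanishing outside `U`. -/
def openSubspace (U : Set X) : Submodule ℂ ℋ :=
  (Submodule.span ℂ
    {w : ℋ | ∃ f : C₀(X, ℂ), (∀ x ∉ U, f x = 0) ∧ ∃ v, M.rep f v = w}).topologicalClosure

/-- The range of the spectral projection `χ_W` for a Borel set `W`. Since the spectral measure of
the representation is outer regular, it is the intersection of the ranges of `χ_U` over all
open `U ⊇ W`. -/
def spectralSubspace (W : Set X) : Submodule ℂ ℋ :=
  ⨅ U : {U : Set X // IsOpen U ∧ W ⊆ U}, M.openSubspace U

theorem isClosed_openSubspace (U : Set X) : IsClosed (M.openSubspace U : Set ℋ) :=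
  Submodule.isClosed_topologicalClosure _

theorem isClosed_spectralSubspace (W : Set X) : IsClosed (M.spectralSubspace W : Set ℋ) := by
  rw [spectralSubspace, Submodule.coe_iInf]
  exact isClosed_iInter fun U => M.isClosed_openSubspace U

instance (U : Set X) : CompleteSpace (M.openSubspace U) :=
  (M.isClosed_openSubspace U).completeSpace_coe

instance (W : Set X) : CompleteSpace (M.spectralSubspace W) :=
  (M.isClosed_spectralSubspace W).completeSpace_coe

/-- The action of the indicator function of the Borel set `W` on `ℋ`, i.e. the value at `W` of the
spectral measure extending the action of `C₀(X)`. -/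
def chi (W : Set X) : ℋ →L[ℂ] ℋ := (M.spectralSubspace W).starProjection

/-- `T` is locally compact if `χ_W T` and `T χ_W` are compact for all bounded Borel sets `W`. -/
def LocallyCompact (T : ℋ →L[ℂ] ℋ) : Prop :=
  ∀ W : Set X, @MeasurableSet X (borel X) W → Bornology.IsBounded W →
    IsCompactOperator (M.chi W * T) ∧ IsCompactOperator (T * M.chi W)

/-- `T` has finite propagation if for some `r ≥ 0` one has `χ_V T χ_W = 0` for all Borel sets with
`d(V, W) > r`. -/
def FinitePropagation (T : ℋ →L[ℂ] ℋ) : Prop :=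
  ∃ r : ℝ, 0 ≤ r ∧ ∀ V W : Set X, @MeasurableSet X (borel X) V → @MeasurableSet X (borel X) W →
    ENNReal.ofReal r < (⨅ v ∈ V, ⨅ w ∈ W, edist v w) → M.chi V * T * M.chi W = 0

section projections

/-- The spectral projection of an open set. -/
def openProj (U : Set X) : ℋ →L[ℂ] ℋ := (M.openSubspace U).starProjection

theorem openProj_mul_self (U : Set X) : M.openProj U * M.openProj U = M.openProj U :=
  (isStarProjection_starProjection (U := M.openSubspace U)).isIdempotentElem.eq

theorem star_openProj (U : Set X) : star (M.openProj U) = M.openProj U :=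
  (isStarProjection_starProjection (U := M.openSubspace U)).isSelfAdjoint.star_eq

theorem openProj_apply_eq {U : Set X} {v : ℋ} (hv : v ∈ M.openSubspace U) :
    M.openProj U v = v :=
  Submodule.starProjection_eq_self_iff.2 hv

theorem openProj_apply_mem (U : Set X) (v : ℋ) : M.openProj U v ∈ M.openSubspace U :=
  Submodule.starProjection_apply_mem _ _

theorem rep_mem_openSubspace {U : Set X} {f : C₀(X, ℂ)} (hf : ∀ x ∉ U, f x = 0) (v : ℋ) :
    M.rep f v ∈ M.openSubspace U :=
  Submodule.le_topologicalClosure _ (Submodule.subset_span ⟨f, hf, v, rfl⟩)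

theorem openSubspace_induction {U : Set X} {K : Submodule ℂ ℋ} (hK : IsClosed (K : Set ℋ))
    (h : ∀ f : C₀(X, ℂ), (∀ x ∉ U, f x = 0) → ∀ v, M.rep f v ∈ K) : M.openSubspace U ≤ K := by
  refine Submodule.topologicalClosure_minimal _ (Submodule.span_le.2 ?_) hK
  rintro _ ⟨f, hf, v, rfl⟩
  exact h f hf v

theorem mul_openProj_eq_of {U : Set X} {S T : ℋ →L[ℂ] ℋ}
    (h : ∀ f : C₀(X, ℂ), (∀ x ∉ U, f x = 0) → S * M.rep f = T * M.rep f) :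
    S * M.openProj U = T * M.openProj U := by
  ext v
  have : M.openSubspace U ≤ LinearMap.ker (S - T : ℋ →L[ℂ] ℋ).toLinearMap := by
    refine M.openSubspace_induction (S - T).isClosed_ker fun f hf w => ?_
    have := DFunLike.congr_fun (h f hf) w
    simpa [sub_eq_zero] using this
  have := this (M.openProj_apply_mem U v)
  simpa [sub_eq_zero] using this

theorem openProj_mul_rep {U : Set X} {f : C₀(X, ℂ)} (hf : ∀ x ∉ U, f x = 0) :
    M.openProj U * M.rep f = M.rep f := by
  ext v
  exact M.openProj_apply_eq (M.rep_mem_openSubspace hf v)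

theorem rep_mul_openProj {U : Set X} {f : C₀(X, ℂ)} (hf : ∀ x ∉ U, f x = 0) :
    M.rep f * M.openProj U = M.rep f := by
  have : M.openProj U * M.rep (star f) = M.rep (star f) :=
    M.openProj_mul_rep fun x hx => by simp [hf x hx]
  have := congrArg star this
  simpa [star_mul, star_openProj, ← map_star] using this

/-- An operator that commutes with the action of `C₀(X)` commutes with spectral projections. -/
theorem commute_openProj {T : ℋ →L[ℂ] ℋ} (hT : ∀ f, M.rep f * T = T * M.rep f) (U : Set X) :
    M.openProj U * T = T * M.openProj U := by
  have key : ∀ S : ℋ →L[ℂ] ℋ, (∀ f, M.rep f * S = S * M.rep f) →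
      M.openProj U * S * M.openProj U = S * M.openProj U := by
    intro S hS
    refine M.mul_openProj_eq_of fun f hf => ?_
    rw [mul_assoc, ← hS, ← mul_assoc, M.openProj_mul_rep hf]
  have h1 := key T hT
  have h2 := key (star T) fun f => by
    have := congrArg star (hT (star f))
    simpa [star_mul, ← map_star] using this.symm
  have h3 := congrArg star h2
  simp only [star_mul, star_openProj, star_star, ← mul_assoc] at h3
  rw [← h3, h1]

theorem rep_comm (f g : C₀(X, ℂ)) : M.rep f * M.rep g = M.rep g * M.rep f := by
  rw [← map_mul, ← map_mul, mul_comm]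

theorem openProj_comm_rep (U : Set X) (g : C₀(X, ℂ)) :
    M.openProj U * M.rep g = M.rep g * M.openProj U :=
  M.commute_openProj (fun f => M.rep_comm f g) U

theorem openProj_comm (U V : Set X) :
    M.openProj U * M.openProj V = M.openProj V * M.openProj U :=
  M.commute_openProj (fun f => (M.openProj_comm_rep V f).symm) U

theorem openProj_mul_of_subset {U V : Set X} (h : U ⊆ V) :
    M.openProj V * M.openProj U = M.openProj U := by
  have := M.mul_openProj_eq_of (U := U) (S := M.openProj V) (T := 1) fun f hf => by
    rw [M.openProj_mul_rep fun x hx => hf x fun hxU => hx (h hxU), one_mul]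
  rwa [one_mul] at this

theorem openProj_mul_of_subset' {U V : Set X} (h : U ⊆ V) :
    M.openProj U * M.openProj V = M.openProj U := by
  rw [M.openProj_comm, M.openProj_mul_of_subset h]

theorem rep_mul_openProj_eq_zero {U : Set X} {f : C₀(X, ℂ)} (hf : ∀ x ∈ U, f x = 0) :
    M.rep f * M.openProj U = 0 := by
  have := M.mul_openProj_eq_of (U := U) (S := M.rep f) (T := 0) fun g hg => by
    rw [← map_mul, zero_mul]
    convert map_zero M.rep
    ext x
    by_cases hx : x ∈ U
    · simp [hf x hx]
    · simp [hg x hx]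
  rwa [zero_mul] at this

theorem openProj_mul_eq_zero {U : Set X} {T : ℋ →L[ℂ] ℋ}
    (h : ∀ f : C₀(X, ℂ), (∀ x ∉ U, f x = 0) → M.rep f * T = 0) : M.openProj U * T = 0 := by
  have := M.mul_openProj_eq_of (U := U) (S := star T) (T := 0) fun f hf => by
    have := congrArg star (h (star f) fun x hx => by simp [hf x hx])
    simpa [star_mul, ← map_star] using this
  have := congrArg star this
  simpa [star_mul, star_openProj] using this

theorem openProj_mul_openProj (U V : Set X) :
    M.openProj U * M.openProj V = M.openProj (U ∩ V) := by
  have h1 : M.openProj (U ∩ V) * M.openProj U * M.openProj V =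
      M.openProj U * M.openProj V := by
    refine M.mul_openProj_eq_of fun g hg => ?_
    have h2 : M.openProj (U ∩ V) * M.rep g * M.openProj U = M.rep g * M.openProj U := by
      refine M.mul_openProj_eq_of fun f hf => ?_
      rw [mul_assoc, ← map_mul]
      refine M.openProj_mul_rep fun x hx => ?_
      by_cases hxV : x ∈ V
      · simp [hf x fun hxU => hx ⟨hxU, hxV⟩]
      · simp [hg x hxV]
    rw [M.openProj_comm_rep U, ← h2, mul_assoc, mul_assoc, M.openProj_comm_rep U]
  rw [← h1, M.openProj_mul_of_subset' Set.inter_subset_left,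
    M.openProj_mul_of_subset' Set.inter_subset_right]

/-- If two open sets cover `X` then their spectral projections span. -/
theorem one_sub_mul_one_sub {U V : Set X} (hU : IsOpen U) (hV : IsOpen V)
    (h : U ∪ V = Set.univ) : (1 - M.openProj U) * (1 - M.openProj V) = 0 := by
  have hdisj : Disjoint Uᶜ Vᶜ := by
    rw [Set.disjoint_iff_inter_eq_empty, ← Set.compl_union, h, Set.compl_univ]
  obtain ⟨φ, hφU, hφV, hφ⟩ :=
    exists_continuous_zero_one_of_isClosed hU.isClosed_compl hV.isClosed_compl hdisj
  have hmul : ∀ (f : C₀(X, ℂ)) (ψ : C(X, ℝ)), (∀ x, ψ x ∈ Set.Icc (0 : ℝ) 1) →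
      ∃ g : C₀(X, ℂ), ∀ x, g x = ψ x * f x := by
    intro f ψ hψ
    refine ⟨⟨⟨fun x => ψ x * f x, by fun_prop⟩, ?_⟩, fun x => rfl⟩
    have h0 := f.zero_at_infty'
    rw [tendsto_zero_iff_norm_tendsto_zero] at h0 ⊢
    refine squeeze_zero (fun _ => norm_nonneg _) (fun x => ?_) h0
    have h1 : ‖(ψ x : ℂ)‖ ≤ 1 := by
      rw [Complex.norm_real, Real.norm_eq_abs, abs_le]
      exact ⟨by linarith [(hψ x).1], (hψ x).2⟩
    calc ‖(ψ x : ℂ) * f x‖ = ‖(ψ x : ℂ)‖ * ‖f x‖ := norm_mul _ _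
      _ ≤ 1 * ‖f x‖ := by gcongr
      _ = ‖f x‖ := one_mul _
  have hrep : ∀ f : C₀(X, ℂ), (1 - M.openProj U) * (1 - M.openProj V) * M.rep f = 0 := by
    intro f
    obtain ⟨g, hg⟩ := hmul f φ hφ
    have hgU : ∀ x ∉ U, g x = 0 := fun x hx => by
      have : φ x = 0 := hφU hx
      rw [hg, this]; simp
    have hgV : ∀ x ∉ V, (f - g) x = 0 := fun x hx => by
      have : φ x = 1 := hφV hx
      rw [ZeroAtInftyContinuousMap.sub_apply, hg, this]; simp
    have e1 : (1 - M.openProj U) * M.rep g = 0 := by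
      rw [sub_mul, one_mul, M.openProj_mul_rep hgU, sub_self]
    have e2 : (1 - M.openProj V) * M.rep (f - g) = 0 := by
      rw [sub_mul, one_mul, M.openProj_mul_rep hgV, sub_self]
    have e3 : (1 - M.openProj V) * M.rep g = M.rep g * (1 - M.openProj V) := by
      rw [sub_mul, mul_sub, M.openProj_comm_rep, one_mul, mul_one]
    have : M.rep f = M.rep g + M.rep (f - g) := by rw [← map_add, add_sub_cancel]
    rw [this, mul_add, mul_assoc, mul_assoc, e2, mul_zero, add_zero, e3, ← mul_assoc, e1, zero_mul]
  ext v
  have hle : (Submodule.span ℂ {w : ℋ | ∃ f v, M.rep f v = w}).topologicalClosure ≤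
      LinearMap.ker ((1 - M.openProj U) * (1 - M.openProj V)).toLinearMap := by
    refine Submodule.topologicalClosure_minimal _ (Submodule.span_le.2 ?_)
      (ContinuousLinearMap.isClosed_ker _)
    rintro _ ⟨f, w, rfl⟩
    exact DFunLike.congr_fun (hrep f) w
  rw [M.nondegenerate] at hle
  exact hle (Submodule.mem_top (x := v))

theorem openProj_mul_eq_self {U V : Set X} (hU : IsOpen U) (hV : IsOpen V)
    (h : U ∪ V = Set.univ) {T : ℋ →L[ℂ] ℋ} (hT : M.openProj V * T = 0) :
    M.openProj U * T = T := by
  have e : (1 - M.openProj V) * T = T := by rw [sub_mul, one_mul, hT, sub_zero]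
  have : (1 - M.openProj U) * T = 0 := by
    rw [← e, ← mul_assoc, M.one_sub_mul_one_sub hU hV h, zero_mul]
  rw [sub_mul, one_mul, sub_eq_zero] at this
  exact this.symm

theorem spectralSubspace_of_isOpen {U : Set X} (hU : IsOpen U) :
    M.spectralSubspace U = M.openSubspace U := by
  refine le_antisymm (iInf_le _ (⟨U, hU, subset_rfl⟩ : {V : Set X // IsOpen V ∧ U ⊆ V})) ?_
  refine le_iInf fun V => M.openSubspace_induction (M.isClosed_openSubspace _) fun f hf v => ?_
  exact M.rep_mem_openSubspace (fun x hx => hf x fun hxU => hx (V.2.2 hxU)) v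

theorem chi_of_isOpen {U : Set X} (hU : IsOpen U) : M.chi U = M.openProj U := by
  unfold chi openProj
  congr 1
  exact M.spectralSubspace_of_isOpen hU

theorem openProj_mul_chi {U W : Set X} (hU : IsOpen U) (h : W ⊆ U) :
    M.openProj U * M.chi W = M.chi W := by
  ext v
  refine M.openProj_apply_eq ?_
  have : M.chi W v ∈ M.spectralSubspace W := Submodule.starProjection_apply_mem _ _
  exact (iInf_le (fun U : {U : Set X // IsOpen U ∧ W ⊆ U} => M.openSubspace U) ⟨U, hU, h⟩) this

theorem chi_mul_openProj {U W : Set X} (hU : IsOpen U) (h : W ⊆ U) :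
    M.chi W * M.openProj U = M.chi W := by
  have hs : star (M.chi W) = M.chi W :=
    (isStarProjection_starProjection (U := M.spectralSubspace W)).isSelfAdjoint.star_eq
  have := congrArg star (M.openProj_mul_chi hU h)
  rwa [star_mul, star_openProj, hs] at this

end projections

end XModule

section compact

variable {ℋ : Type*} [NormedAddCommGroup ℋ] [InnerProductSpace ℂ ℋ] [CompleteSpace ℋ]

theorem isCompactOperator_star {K : ℋ →L[ℂ] ℋ} (hK : IsCompactOperator K) :
    IsCompactOperator (star K : ℋ →L[ℂ] ℋ) := by
  have hc : IsCompactOperator (K * star K) := hK.comp_clm (star K)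
  have htb : TotallyBounded ((K * star K) '' Metric.closedBall (0 : ℋ) 1) := by
    have := hc.isCompact_closure_image_closedBall (f := (K * star K).toLinearMap) 1
    exact (this.totallyBounded).subset subset_closure
  refine (isCompactOperator_iff_isCompact_closure_image_closedBall
    (star K).toLinearMap one_pos).2 ?_
  refine TotallyBounded.isCompact_of_isClosed (TotallyBounded.closure ?_) isClosed_closure
  rw [Metric.totallyBounded_iff]
  intro ε hε
  have hnet := totallyBounded_iff_subset.1 htb _
    (Metric.dist_mem_uniformity (show 0 < ε ^ 2 / 4 by positivity))
  obtain ⟨t', ht's, ht'f, ht⟩ := Set.exists_subset_image_finite_and.1 hnet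
  refine ⟨(star K : ℋ →L[ℂ] ℋ) '' t', ht'f.image _, ?_⟩
  rintro _ ⟨x, hx, rfl⟩
  have := ht ⟨x, hx, rfl⟩
  simp only [Set.mem_iUnion, Set.mem_image, exists_prop, exists_exists_and_eq_and,
    Set.mem_ofPred_eq] at this ⊢
  obtain ⟨y, hy, hxy⟩ := this
  refine ⟨y, hy, ?_⟩
  rw [Metric.mem_ball, dist_eq_norm]
  have h1 : ‖(star K) (x - y)‖ ^ 2 ≤ ‖(K * star K) (x - y)‖ * ‖x - y‖ := by
    have e : inner ℂ ((K * star K) (x - y)) (x - y) =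
        inner ℂ ((star K) (x - y)) ((star K) (x - y)) := by
      rw [mul_apply_eq_comp, ContinuousLinearMap.star_eq_adjoint,
        ContinuousLinearMap.adjoint_inner_right]
    have e2 : ((‖(star K) (x - y)‖ ^ 2 : ℝ) : ℂ) = inner ℂ ((K * star K) (x - y)) (x - y) := by
      rw [e, inner_self_eq_norm_sq_to_K]; norm_cast
    calc ‖(star K) (x - y)‖ ^ 2 = ‖((‖(star K) (x - y)‖ ^ 2 : ℝ) : ℂ)‖ := by
          rw [Complex.norm_real, Real.norm_of_nonneg (by positivity)]
      _ ≤ _ := by rw [e2]; exact norm_inner_le_norm _ _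
  have h2 : ‖(K * star K) (x - y)‖ < ε ^ 2 / 4 := by
    rw [map_sub, ← dist_eq_norm]; exact hxy
  have h3 : ‖x - y‖ ≤ 2 := by
    have hx' := mem_closedBall_zero_iff.1 hx
    have hy' := mem_closedBall_zero_iff.1 (ht's hy)
    exact (norm_sub_le _ _).trans (by linarith)
  have h4 : ‖(star K) (x - y)‖ ^ 2 < ε ^ 2 := by
    nlinarith [norm_nonneg (x - y), norm_nonneg ((K * star K) (x - y))]
  have := (sq_lt_sq₀ (norm_nonneg _) hε.le).1 h4
  rwa [map_sub] at this

end compact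

namespace XModule

variable (M : XModule X ℋ)

section propagation

theorem star_chi (W : Set X) : star (M.chi W) = M.chi W :=
  (isStarProjection_starProjection (U := M.spectralSubspace W)).isSelfAdjoint.star_eq

theorem chi_comm_openProj (W U : Set X) : M.chi W * M.openProj U = M.openProj U * M.chi W := by
  have h1 : M.chi W * (M.openProj U * M.chi W) = M.openProj U * M.chi W := by
    ext v
    refine Submodule.starProjection_eq_self_iff.2 ?_
    have hv : M.chi W v ∈ M.spectralSubspace W := Submodule.starProjection_apply_mem _ _
    rw [spectralSubspace, Submodule.mem_iInf] at hv ⊢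
    intro V
    have := DFunLike.congr_fun (M.openProj_comm U V) (M.chi W v)
    rw [mul_apply_eq_comp, mul_apply_eq_comp,
      M.openProj_apply_eq (hv V)] at this
    change M.openProj U (M.chi W v) ∈ _
    rw [this]
    exact M.openProj_apply_mem _ _
  have h2 := congrArg star h1
  simp only [star_mul, star_chi, star_openProj] at h2
  rw [← h1, ← mul_assoc, h2]

/-- The propagation of `T` is at most `r`, tested on open sets. -/
def PropLE (T : ℋ →L[ℂ] ℋ) (r : ℝ) : Prop :=
  ∀ V W : Set X, IsOpen V → IsOpen W → (∀ v ∈ V, ∀ w ∈ W, r < dist v w) →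
    M.openProj V * T * M.openProj W = 0

variable {M}

theorem PropLE.mono {T : ℋ →L[ℂ] ℋ} {r s : ℝ} (h : M.PropLE T r) (hrs : r ≤ s) :
    M.PropLE T s :=
  fun V W hV hW hd => h V W hV hW fun v hv w hw => hrs.trans_lt (hd v hv w hw)

theorem FinitePropagation.exists_propLE {T : ℋ →L[ℂ] ℋ} (h : M.FinitePropagation T) :
    ∃ r, 0 ≤ r ∧ M.PropLE T r := by
  obtain ⟨r, hr, h⟩ := h
  refine ⟨r + 1, by linarith, fun V W hV hW hd => ?_⟩
  rw [← M.chi_of_isOpen hV, ← M.chi_of_isOpen hW]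
  borelize X
  refine h V W hV.measurableSet hW.measurableSet ?_
  refine ((ENNReal.ofReal_lt_ofReal_iff (by linarith)).2 (lt_add_one r)).trans_le ?_
  refine le_iInf₂ fun v hv => le_iInf₂ fun w hw => ?_
  rw [edist_dist]
  exact ENNReal.ofReal_le_ofReal (hd v hv w hw).le

theorem PropLE.finitePropagation {T : ℋ →L[ℂ] ℋ} {r : ℝ} (hr : 0 ≤ r) (h : M.PropLE T r) :
    M.FinitePropagation T := by
  refine ⟨r + 1, by linarith, fun V W _ _ hd => ?_⟩
  have := h (Metric.thickening (1 / 2) V) (Metric.thickening (1 / 2) W)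
    Metric.isOpen_thickening Metric.isOpen_thickening ?_
  · rw [← M.chi_mul_openProj Metric.isOpen_thickening
      (Metric.self_subset_thickening (show (0 : ℝ) < 1 / 2 by norm_num) V),
      ← M.openProj_mul_chi Metric.isOpen_thickening
      (Metric.self_subset_thickening (show (0 : ℝ) < 1 / 2 by norm_num) W)]
    rw [← mul_assoc, mul_assoc (M.chi V), mul_assoc (M.chi V), this, mul_zero, zero_mul]
  · intro v hv w hw
    obtain ⟨v', hv', hvv'⟩ := Metric.mem_thickening_iff.1 hv
    obtain ⟨w', hw', hww'⟩ := Metric.mem_thickening_iff.1 hw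
    have h1 : ENNReal.ofReal (r + 1) < edist v' w' :=
      hd.trans_le ((iInf₂_le v' hv').trans (iInf₂_le w' hw'))
    rw [edist_dist] at h1
    have h2 := (ENNReal.ofReal_lt_ofReal_iff_of_nonneg (by linarith)).1 h1
    have h3 := dist_triangle4 v' v w w'
    rw [dist_comm v' v] at h3
    linarith

theorem PropLE.star {T : ℋ →L[ℂ] ℋ} {r : ℝ} (h : M.PropLE T r) : M.PropLE (star T) r := by
  intro V W hV hW hd
  have := congrArg Star.star (h W V hW hV fun w hw v hv => by rw [dist_comm]; exact hd v hv w hw)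
  simpa [star_mul, star_openProj, mul_assoc] using this

/-- An operator of propagation at most `r` spreads supports by at most `r`. -/
theorem PropLE.push {T : ℋ →L[ℂ] ℋ} {r : ℝ} (hr : 0 ≤ r) (h : M.PropLE T r) {s : ℝ}
    (hs : 0 < s) (S : Set X) :
    M.openProj (Metric.thickening (s + r + 1) S) * (T * M.openProj (Metric.thickening s S)) =
      T * M.openProj (Metric.thickening s S) := by
  refine M.openProj_mul_eq_self Metric.isOpen_thickening
    (V := (Metric.cthickening (s + r) S)ᶜ) Metric.isClosed_cthickening.isOpen_compl ?_ ?_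
  · rw [Set.eq_univ_iff_forall]
    intro x
    by_cases hx : x ∈ Metric.cthickening (s + r) S
    · exact .inl (Metric.cthickening_subset_thickening' (by linarith) (by linarith) S hx)
    · exact .inr hx
  · rw [← mul_assoc]
    refine h _ _ Metric.isClosed_cthickening.isOpen_compl Metric.isOpen_thickening ?_
    intro v hv w hw
    by_contra! hle
    refine hv ?_
    obtain ⟨z, hz, hwz⟩ := Metric.mem_thickening_iff.1 hw
    refine Metric.mem_cthickening_of_dist_le v z _ S hz ?_
    have := dist_triangle v w z
    linarith

theorem PropLE.mul {S T : ℋ →L[ℂ] ℋ} {r s : ℝ} (hr : 0 ≤ r) (hs : 0 ≤ s)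
    (hS : M.PropLE S r) (hT : M.PropLE T s) : M.PropLE (S * T) (r + (1 + s + 1)) := by
  intro V W hV hW hd
  have hW' : M.openProj (Metric.thickening 1 W) * M.openProj W = M.openProj W :=
    M.openProj_mul_of_subset (Metric.self_subset_thickening one_pos W)
  have e := hT.push hs one_pos W
  have e0 : M.openProj V * S * M.openProj (Metric.thickening (1 + s + 1) W) = 0 := by
    refine hS _ _ hV Metric.isOpen_thickening fun v hv w hw => ?_
    obtain ⟨z, hz, hwz⟩ := Metric.mem_thickening_iff.1 hw
    have := hd v hv z hz
    have := dist_triangle v w z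
    linarith
  calc M.openProj V * (S * T) * M.openProj W
      = M.openProj V * S * (T * M.openProj (Metric.thickening 1 W)) * M.openProj W := by
        rw [← hW']; simp only [mul_assoc]; rw [hW', hW']
    _ = (M.openProj V * S * M.openProj (Metric.thickening (1 + s + 1) W)) *
          (T * M.openProj (Metric.thickening 1 W)) * M.openProj W := by
        rw [← e]; simp only [mul_assoc]
        rw [← mul_assoc (M.openProj (Metric.thickening (1 + s + 1) W))
          (M.openProj (Metric.thickening (1 + s + 1) W)), M.openProj_mul_self]
    _ = 0 := by rw [e0, zero_mul, zero_mul]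

variable (M)

/-- The star algebra of locally compact operators of finite propagation. -/
def roeCore : NonUnitalStarSubalgebra ℂ (ℋ →L[ℂ] ℋ) where
  carrier := {T | M.LocallyCompact T ∧ M.FinitePropagation T}
  zero_mem' := by
    refine ⟨fun W _ _ => ?_, 0, le_rfl, fun V W _ _ _ => by simp⟩
    rw [mul_zero, zero_mul]
    exact ⟨isCompactOperator_zero, isCompactOperator_zero⟩
  add_mem' := by
    rintro S T ⟨hS, hS'⟩ ⟨hT, hT'⟩
    refine ⟨fun W hW hb => ?_, ?_⟩
    · rw [mul_add, add_mul]
      exact ⟨(hS W hW hb).1.add (hT W hW hb).1, (hS W hW hb).2.add (hT W hW hb).2⟩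
    · obtain ⟨r, hr, hS'⟩ := hS'.exists_propLE
      obtain ⟨s, hs, hT'⟩ := hT'.exists_propLE
      refine PropLE.finitePropagation (r := max r s) (hr.trans (le_max_left _ _)) ?_
      intro V W hV hW hd
      rw [mul_add, add_mul, hS'.mono (le_max_left _ _) V W hV hW hd,
        hT'.mono (le_max_right _ _) V W hV hW hd, add_zero]
  smul_mem' := by
    rintro c T ⟨hT, r, hr, hT'⟩
    refine ⟨fun W hW hb => ?_, r, hr, fun V W hV hW hd => ?_⟩
    · rw [mul_smul_comm, smul_mul_assoc]
      exact ⟨(hT W hW hb).1.smul c, (hT W hW hb).2.smul c⟩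
    · rw [mul_smul_comm, smul_mul_assoc, hT' V W hV hW hd, smul_zero]
  mul_mem' := by
    rintro S T ⟨hS, hS'⟩ ⟨hT, hT'⟩
    refine ⟨fun W hW hb => ?_, ?_⟩
    · rw [← mul_assoc, mul_assoc S]
      exact ⟨(hS W hW hb).1.comp_clm T, (hT W hW hb).2.clm_comp S⟩
    · obtain ⟨r, hr, hS'⟩ := hS'.exists_propLE
      obtain ⟨s, hs, hT'⟩ := hT'.exists_propLE
      exact (hS'.mul hr hs hT').finitePropagation (by linarith)
  star_mem' := by
    rintro T ⟨hT, hT'⟩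
    refine ⟨fun W hW hb => ?_, ?_⟩
    · have h1 := isCompactOperator_star (hT W hW hb).2
      have h2 := isCompactOperator_star (hT W hW hb).1
      rw [StarMul.star_mul (R := ℋ →L[ℂ] ℋ), star_chi] at h1 h2
      exact ⟨h1, h2⟩
    · obtain ⟨r, hr, hT'⟩ := hT'.exists_propLE
      exact hT'.star.finitePropagation hr

/-- The Roe algebra `C*_Roe(X)`: the norm closure of the locally compact operators of finite
propagation. -/
def roeAlgebra : NonUnitalStarSubalgebra ℂ (ℋ →L[ℂ] ℋ) := M.roeCore.topologicalClosure

instance : IsClosed (M.roeAlgebra : Set (ℋ →L[ℂ] ℋ)) :=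
  NonUnitalStarSubalgebra.isClosed_topologicalClosure _

theorem mul_openProj_mem_core {T : ℋ →L[ℂ] ℋ} (hT : T ∈ M.roeCore) (U : Set X) :
    T * M.openProj U ∈ M.roeCore := by
  obtain ⟨hT, hT'⟩ := hT
  refine ⟨fun W hW hb => ?_, ?_⟩
  · rw [← mul_assoc, mul_assoc T, ← chi_comm_openProj, ← mul_assoc]
    exact ⟨(hT W hW hb).1.comp_clm _, (hT W hW hb).2.comp_clm _⟩
  · obtain ⟨r, hr, hT'⟩ := hT'.exists_propLE
    refine PropLE.finitePropagation (r := r) hr fun V W hV hW hd => ?_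
    rw [mul_assoc, mul_assoc, M.openProj_comm, ← mul_assoc T, ← mul_assoc, ← mul_assoc,
      hT' V W hV hW hd, zero_mul]

/-- Right multiplication by an operator preserving a set `s` preserves its closure. -/
theorem mem_closure_of_mul_right {s t : Set (ℋ →L[ℂ] ℋ)} {D T : ℋ →L[ℂ] ℋ} (hT : T ∈ closure s)
    (h : ∀ S ∈ s, S * D ∈ t) : T * D ∈ closure t :=
  map_mem_closure (f := fun S => S * D) (continuous_id.mul continuous_const) hT h

theorem mul_openProj_mem_roe {T : ℋ →L[ℂ] ℋ} (hT : T ∈ M.roeAlgebra) (U : Set X) :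
    T * M.openProj U ∈ M.roeAlgebra :=
  mem_closure_of_mul_right hT fun _ hS => M.mul_openProj_mem_core hS U

theorem openProj_mul_mem_roe {T : ℋ →L[ℂ] ℋ} (hT : T ∈ M.roeAlgebra) (U : Set X) :
    M.openProj U * T ∈ M.roeAlgebra := by
  have := star_mem (M.mul_openProj_mem_roe (star_mem hT) U)
  simpa [star_mul, star_openProj] using this

end propagation

end XModule

/-- A big family of subsets of `X`. -/
structure BigFamily (X : Type*) [MetricSpace X] where
  sets : Set (Set X)
  nonempty : sets.Nonempty
  exists_union : ∀ Y₁ ∈ sets, ∀ Y₂ ∈ sets, ∀ r > 0, ∃ Y' ∈ sets,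
    {x | ∃ y ∈ Y₁, dist x y ≤ r} ∪ {x | ∃ y ∈ Y₂, dist x y ≤ r} ⊆ Y'

namespace BigFamily

/-- The big family `{Y}` of all subsets of uniform thickenings of `Y`. -/
def ofSet (Y : Set X) : BigFamily X where
  sets := {Z | ∃ r > 0, Z ⊆ {x | ∃ y ∈ Y, dist x y ≤ r}}
  nonempty := ⟨∅, 1, one_pos, Set.empty_subset _⟩
  exists_union := by
    rintro Y₁ ⟨r₁, hr₁, h₁⟩ Y₂ ⟨r₂, hr₂, h₂⟩ r hr
    refine ⟨{x | ∃ y ∈ Y, dist x y ≤ r + (r₁ + r₂)}, ⟨_, by positivity, subset_rfl⟩, ?_⟩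
    rintro x (⟨y, hy, hxy⟩ | ⟨y, hy, hxy⟩)
    · obtain ⟨z, hz, hyz⟩ := h₁ hy
      exact ⟨z, hz, (dist_triangle x y z).trans (by linarith)⟩
    · obtain ⟨z, hz, hyz⟩ := h₂ hy
      exact ⟨z, hz, (dist_triangle x y z).trans (by linarith)⟩

/-- The intersection `𝒴 ∩ 𝒴' = {Y ∩ Y' | Y ∈ 𝒴, Y' ∈ 𝒴'}` of two big families. -/
def inter (𝒴 𝒵 : BigFamily X) : BigFamily X where
  sets := {W | ∃ Y ∈ 𝒴.sets, ∃ Z ∈ 𝒵.sets, W = Y ∩ Z}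
  nonempty := by
    obtain ⟨Y, hY⟩ := 𝒴.nonempty
    obtain ⟨Z, hZ⟩ := 𝒵.nonempty
    exact ⟨Y ∩ Z, Y, hY, Z, hZ, rfl⟩
  exists_union := by
    rintro _ ⟨Y₁, hY₁, Z₁, hZ₁, rfl⟩ _ ⟨Y₂, hY₂, Z₂, hZ₂, rfl⟩ r hr
    obtain ⟨Y', hY', hY⟩ := 𝒴.exists_union Y₁ hY₁ Y₂ hY₂ r hr
    obtain ⟨Z', hZ', hZ⟩ := 𝒵.exists_union Z₁ hZ₁ Z₂ hZ₂ r hr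
    refine ⟨_, ⟨Y', hY', Z', hZ', rfl⟩, ?_⟩
    rintro x (⟨y, hy, hxy⟩ | ⟨y, hy, hxy⟩)
    · exact ⟨hY (.inl ⟨y, hy.1, hxy⟩), hZ (.inl ⟨y, hy.2, hxy⟩)⟩
    · exact ⟨hY (.inr ⟨y, hy.1, hxy⟩), hZ (.inr ⟨y, hy.2, hxy⟩)⟩

/-- The coarse boundary `∂Y = {Y} ∩ {X ∖ Y}`. -/
def coarseBoundary (Y : Set X) : BigFamily X := (ofSet Y).inter (ofSet Yᶜ)

end BigFamily

namespace XModule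

variable (M : XModule X ℋ)

/-- `T` is supported in `Z`: `f T = T f = 0` for all `f ∈ C₀(X)` with support in `X ∖ Z`. -/
def SupportedIn (T : ℋ →L[ℂ] ℋ) (Z : Set X) : Prop :=
  ∀ f : C₀(X, ℂ), tsupport f ⊆ Zᶜ → M.rep f * T = 0 ∧ T * M.rep f = 0

variable {M} in
theorem SupportedIn.mono {T : ℋ →L[ℂ] ℋ} {Z Z' : Set X} (h : M.SupportedIn T Z) (hZ : Z ⊆ Z') :
    M.SupportedIn T Z' :=
  fun f hf => h f (hf.trans (Set.compl_subset_compl.2 hZ))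

theorem subset_of_exists_union {Y : Set X} {r : ℝ} (hr : 0 < r) :
    Y ⊆ {x | ∃ y ∈ Y, dist x y ≤ r} :=
  fun x hx => ⟨x, hx, by rw [dist_self]; exact hr.le⟩

/-- The star algebra of the elements of the Roe algebra supported in the big family `𝒴`. -/
def localizedCore (𝒴 : BigFamily X) : NonUnitalStarSubalgebra ℂ (ℋ →L[ℂ] ℋ) where
  carrier := {T | T ∈ M.roeAlgebra ∧ ∃ Z ∈ 𝒴.sets, M.SupportedIn T Z}
  zero_mem' := by
    obtain ⟨Z, hZ⟩ := 𝒴.nonempty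
    exact ⟨zero_mem _, Z, hZ, fun f _ => by simp⟩
  add_mem' := by
    rintro S T ⟨hS, Y, hY, hSY⟩ ⟨hT, Z, hZ, hTZ⟩
    obtain ⟨W, hW, h⟩ := 𝒴.exists_union Y hY Z hZ 1 one_pos
    rw [Set.union_subset_iff] at h
    refine ⟨add_mem hS hT, W, hW, fun f hf => ?_⟩
    have h1 := hSY.mono ((subset_of_exists_union one_pos).trans h.1) f hf
    have h2 := hTZ.mono ((subset_of_exists_union one_pos).trans h.2) f hf
    rw [mul_add, add_mul, h1.1, h1.2, h2.1, h2.2, add_zero]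
    exact ⟨rfl, rfl⟩
  smul_mem' := by
    rintro c T ⟨hT, Z, hZ, hTZ⟩
    refine ⟨SMulMemClass.smul_mem c hT, Z, hZ, fun f hf => ?_⟩
    rw [mul_smul_comm, smul_mul_assoc, (hTZ f hf).1, (hTZ f hf).2, smul_zero]
    exact ⟨rfl, rfl⟩
  mul_mem' := by
    rintro S T ⟨hS, Y, hY, hSY⟩ ⟨hT, Z, hZ, hTZ⟩
    obtain ⟨W, hW, h⟩ := 𝒴.exists_union Y hY Z hZ 1 one_pos
    rw [Set.union_subset_iff] at h
    refine ⟨mul_mem hS hT, W, hW, fun f hf => ?_⟩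
    have h1 := hSY.mono ((subset_of_exists_union one_pos).trans h.1) f hf
    have h2 := hTZ.mono ((subset_of_exists_union one_pos).trans h.2) f hf
    rw [← mul_assoc, h1.1, mul_assoc, h2.2, zero_mul, mul_zero]
    exact ⟨rfl, rfl⟩
  star_mem' := by
    rintro T ⟨hT, Z, hZ, hTZ⟩
    refine ⟨star_mem hT, Z, hZ, fun f hf => ?_⟩
    have hf' : tsupport (star f : C₀(X, ℂ)) ⊆ Zᶜ := by
      refine subset_trans (closure_mono fun x hx => ?_) hf
      simpa using hx
    have h1 := congrArg star (hTZ _ hf').1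
    have h2 := congrArg star (hTZ _ hf').2
    rw [StarMul.star_mul (R := ℋ →L[ℂ] ℋ), ← map_star, star_star, star_zero] at h1 h2
    exact ⟨h2, h1⟩

/-- The localized Roe algebra `C*_Roe(𝒴)`. -/
def localizedRoe (𝒴 : BigFamily X) : NonUnitalStarSubalgebra ℂ (ℋ →L[ℂ] ℋ) :=
  (M.localizedCore 𝒴).topologicalClosure

instance (𝒴 : BigFamily X) : IsClosed (M.localizedRoe 𝒴 : Set (ℋ →L[ℂ] ℋ)) :=
  NonUnitalStarSubalgebra.isClosed_topologicalClosure _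

theorem localizedRoe_le (𝒴 : BigFamily X) : M.localizedRoe 𝒴 ≤ M.roeAlgebra :=
  NonUnitalStarSubalgebra.topologicalClosure_minimal _ (fun _ hT => hT.1)
    (NonUnitalStarSubalgebra.isClosed_topologicalClosure _)

section MayerVietoris

variable {M}

theorem SupportedIn.openProj_mul {T : ℋ →L[ℂ] ℋ} {Z : Set X} (h : M.SupportedIn T Z) {ε : ℝ}
    (hε : 0 < ε) : M.openProj (Metric.thickening ε Z) * T = T := by
  refine M.openProj_mul_eq_self Metric.isOpen_thickening
    (V := (Metric.cthickening (ε / 2) Z)ᶜ) Metric.isClosed_cthickening.isOpen_compl ?_ ?_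
  · rw [Set.eq_univ_iff_forall]
    intro x
    by_cases hx : x ∈ Metric.cthickening (ε / 2) Z
    · exact .inl (Metric.cthickening_subset_thickening' hε (by linarith) Z hx)
    · exact .inr hx
  · refine M.openProj_mul_eq_zero fun f hf => (h f ?_).1
    have h1 : tsupport f ⊆ (Metric.thickening (ε / 2) Z)ᶜ := by
      refine closure_minimal (fun x hx hx' => hx (hf x fun hx'' => hx'' ?_))
        Metric.isOpen_thickening.isClosed_compl
      exact Metric.thickening_subset_cthickening _ _ hx'
    exact h1.trans (Set.compl_subset_compl.2 (Metric.self_subset_thickening (by linarith) Z))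

theorem SupportedIn.star {T : ℋ →L[ℂ] ℋ} {Z : Set X} (hTZ : M.SupportedIn T Z) :
    M.SupportedIn (star T) Z := by
  intro f hf
  have hf' : tsupport (Star.star f : C₀(X, ℂ)) ⊆ Zᶜ := by
    refine subset_trans (closure_mono fun x hx => ?_) hf
    simpa using hx
  have h1 := congrArg Star.star (hTZ _ hf').1
  have h2 := congrArg Star.star (hTZ _ hf').2
  rw [StarMul.star_mul (R := ℋ →L[ℂ] ℋ), ← map_star, star_star, star_zero] at h1 h2
  exact ⟨h2, h1⟩

theorem SupportedIn.mul_openProj {T : ℋ →L[ℂ] ℋ} {Z : Set X} (h : M.SupportedIn T Z) {ε : ℝ}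
    (hε : 0 < ε) : T * M.openProj (Metric.thickening ε Z) = T := by
  have := congrArg Star.star (h.star.openProj_mul hε)
  rwa [StarMul.star_mul (R := ℋ →L[ℂ] ℋ), star_openProj, star_star] at this

variable (M)

theorem supportedIn_of_openProj {T : ℋ →L[ℂ] ℋ} {U : Set X} (h1 : M.openProj U * T = T)
    (h2 : T * M.openProj U = T) : M.SupportedIn T U := by
  intro f hf
  have hf' : ∀ x ∈ U, f x = 0 := fun x hx => image_eq_zero_of_notMem_tsupport fun h => hf h hx
  have e1 := M.rep_mul_openProj_eq_zero hf'
  have e2 := e1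
  rw [← M.openProj_comm_rep] at e2
  exact ⟨by rw [← h1, ← mul_assoc, e1, zero_mul], by rw [← h2, mul_assoc, e2, mul_zero]⟩

theorem thickening_mem_ofSet {s : ℝ} (hs : 0 < s) (Y : Set X) :
    Metric.thickening s Y ∈ (BigFamily.ofSet Y).sets := by
  refine ⟨s, hs, fun x hx => ?_⟩
  obtain ⟨y, hy, hxy⟩ := Metric.mem_thickening_iff.1 hx
  exact ⟨y, hy, hxy.le⟩

theorem exists_openProj_of_mem {Y : Set X} {T : ℋ →L[ℂ] ℋ}
    (hT : T ∈ M.localizedCore (.ofSet Y)) : ∃ s > 0,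
      M.openProj (Metric.thickening s Y) * T = T ∧ T * M.openProj (Metric.thickening s Y) = T := by
  obtain ⟨-, Z, ⟨r, hr, hZ⟩, hTZ⟩ := hT
  have hsub : Metric.thickening 1 Z ⊆ Metric.thickening (r + 1) Y := by
    intro x hx
    obtain ⟨z, hz, hxz⟩ := Metric.mem_thickening_iff.1 hx
    obtain ⟨y, hy, hzy⟩ := hZ hz
    exact Metric.mem_thickening_iff.2 ⟨y, hy, (dist_triangle x z y).trans_lt (by linarith)⟩
  refine ⟨r + 1, by linarith, ?_, ?_⟩
  · rw [← hTZ.openProj_mul one_pos, ← mul_assoc, M.openProj_mul_of_subset hsub]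
  · rw [← hTZ.mul_openProj one_pos, mul_assoc, M.openProj_mul_of_subset' hsub]

theorem mem_core_of_openProj {Y : Set X} {T : ℋ →L[ℂ] ℋ} (hT : T ∈ M.roeAlgebra) {s : ℝ}
    (hs : 0 < s) (h1 : M.openProj (Metric.thickening s Y) * T = T)
    (h2 : T * M.openProj (Metric.thickening s Y) = T) : T ∈ M.localizedCore (.ofSet Y) :=
  ⟨hT, _, thickening_mem_ofSet hs Y, M.supportedIn_of_openProj h1 h2⟩

/-- `T D` is localized near `Y` if `D` is. -/
theorem mul_mem_localizedRoe_of {Y : Set X} {T D : ℋ →L[ℂ] ℋ} (hT : T ∈ M.roeAlgebra) {s : ℝ}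
    (hs : 0 < s) (h1 : M.openProj (Metric.thickening s Y) * D = D)
    (h2 : D * M.openProj (Metric.thickening s Y) = D)
    (hD : ∀ S ∈ M.roeAlgebra, S * D ∈ M.roeAlgebra) : T * D ∈ M.localizedRoe (.ofSet Y) := by
  refine mem_closure_of_mul_right hT fun S hS => ?_
  obtain ⟨r, hr, hS'⟩ := hS.2.exists_propLE
  have hsub : Metric.thickening s Y ⊆ Metric.thickening (s + r + 1) Y :=
    Metric.thickening_mono (by linarith) Y
  refine M.mem_core_of_openProj (s := s + r + 1)
    (hD S (NonUnitalStarSubalgebra.le_topologicalClosure _ hS)) (by linarith) ?_ ?_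
  · rw [← h1, ← mul_assoc S, ← mul_assoc, hS'.push hr hs]
  · rw [← h2, ← mul_assoc S, mul_assoc, M.openProj_mul_of_subset' hsub]

theorem mul_mem_localizedRoe {Y : Set X} {T D : ℋ →L[ℂ] ℋ} (hT : T ∈ M.roeAlgebra)
    (hD : D ∈ M.localizedRoe (.ofSet Y)) : T * D ∈ M.localizedRoe (.ofSet Y) := by
  have hcl : T * D ∈ closure (M.localizedRoe (.ofSet Y) : Set (ℋ →L[ℂ] ℋ)) := by
    refine map_mem_closure (f := fun S => T * S) (continuous_const.mul continuous_id) hD ?_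
    intro S hS
    obtain ⟨s, hs, h1, h2⟩ := M.exists_openProj_of_mem hS
    exact M.mul_mem_localizedRoe_of hT hs h1 h2 fun R hR => mul_mem hR hS.1
  exact (inferInstance : IsClosed (M.localizedRoe (.ofSet Y) : Set (ℋ →L[ℂ] ℋ))).closure_subset
    hcl

theorem norm_openProj_le (U : Set X) : ‖M.openProj U‖ ≤ 1 :=
  Submodule.starProjection_norm_le _

theorem norm_openProj_mul_mul_le (U : Set X) (T : ℋ →L[ℂ] ℋ) :
    ‖M.openProj U * T * M.openProj U‖ ≤ ‖T‖ := by
  have h1 := norm_mul_le (M.openProj U * T) (M.openProj U)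
  have h2 := norm_mul_le (M.openProj U) T
  have h3 := M.norm_openProj_le U
  nlinarith [norm_nonneg T, norm_nonneg (M.openProj U), norm_nonneg (M.openProj U * T)]

theorem exists_norm_sub_lt {Y : Set X} {T : ℋ →L[ℂ] ℋ} (hT : T ∈ M.localizedRoe (.ofSet Y))
    {ε : ℝ} (hε : 0 < ε) : ∃ s > 0, ‖T - M.openProj (Metric.thickening s Y) * T *
      M.openProj (Metric.thickening s Y)‖ < ε := by
  obtain ⟨S, hS, hTS⟩ := Metric.mem_closure_iff.1 hT (ε / 2) (by linarith)
  obtain ⟨s, hs, h1, h2⟩ := M.exists_openProj_of_mem hS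
  refine ⟨s, hs, ?_⟩
  set P := M.openProj (Metric.thickening s Y)
  have e : T - P * T * P = (T - S) - P * (T - S) * P := by
    rw [mul_sub, sub_mul, h1, h2]; abel
  rw [dist_eq_norm] at hTS
  rw [e]
  have h3 := norm_sub_le (T - S) (P * (T - S) * P)
  have h4 := M.norm_openProj_mul_mul_le (Metric.thickening s Y) (T - S)
  change ‖P * (T - S) * P‖ ≤ _ at h4
  linarith

theorem localizedRoe_mono {𝒴 𝒵 : BigFamily X} (h : ∀ Y ∈ 𝒴.sets, ∃ Z ∈ 𝒵.sets, Y ⊆ Z) :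
    M.localizedRoe 𝒴 ≤ M.localizedRoe 𝒵 := by
  refine NonUnitalStarSubalgebra.topologicalClosure_mono ?_
  rintro T ⟨hT, Y, hY, hTY⟩
  obtain ⟨Z, hZ, hYZ⟩ := h Y hY
  exact ⟨hT, Z, hZ, hTY.mono hYZ⟩

theorem mem_localizedRoe_coarseBoundary {Y : Set X} {T : ℋ →L[ℂ] ℋ} :
    T ∈ M.localizedRoe (.coarseBoundary Y) ↔
      T ∈ M.localizedRoe (.ofSet Y) ∧ T ∈ M.localizedRoe (.ofSet Yᶜ) := by
  constructor
  · refine fun hT => ⟨M.localizedRoe_mono ?_ hT, M.localizedRoe_mono ?_ hT⟩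
    · rintro _ ⟨Z, hZ, Z', hZ', rfl⟩
      exact ⟨Z, hZ, Set.inter_subset_left⟩
    · rintro _ ⟨Z, hZ, Z', hZ', rfl⟩
      exact ⟨Z', hZ', Set.inter_subset_right⟩
  · rintro ⟨h1, h2⟩
    refine Metric.mem_closure_iff.2 fun ε hε => ?_
    obtain ⟨s, hs, hs'⟩ := M.exists_norm_sub_lt h1 (half_pos hε)
    obtain ⟨t, ht, ht'⟩ := M.exists_norm_sub_lt h2 (half_pos hε)
    set U := Metric.thickening s Y with hU
    set U' := Metric.thickening t Yᶜ with hU'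
    have hTr : T ∈ M.roeAlgebra := M.localizedRoe_le _ h1
    refine ⟨M.openProj (U ∩ U') * T * M.openProj (U ∩ U'), ⟨?_, U ∩ U', ?_, ?_⟩, ?_⟩
    · exact M.mul_openProj_mem_roe (M.openProj_mul_mem_roe hTr _) _
    · exact ⟨U, thickening_mem_ofSet hs Y, U', thickening_mem_ofSet ht Yᶜ, rfl⟩
    · refine M.supportedIn_of_openProj ?_ ?_
      · rw [← mul_assoc, ← mul_assoc, M.openProj_mul_self]
      · rw [mul_assoc, M.openProj_mul_self]
    · rw [dist_eq_norm]
      have e : T - M.openProj (U ∩ U') * T * M.openProj (U ∩ U') =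
          (T - M.openProj U * T * M.openProj U) +
            M.openProj U * (T - M.openProj U' * T * M.openProj U') * M.openProj U := by
        have e1 := M.openProj_mul_openProj U U'
        have e2 := e1
        rw [M.openProj_comm] at e2
        nth_rewrite 1 [← e1]
        rw [← e2]
        simp only [mul_sub, sub_mul, mul_assoc]
        abel
      rw [e]
      have h3 := norm_add_le (T - M.openProj U * T * M.openProj U)
        (M.openProj U * (T - M.openProj U' * T * M.openProj U') * M.openProj U)
      have h4 := M.norm_openProj_mul_mul_le U (T - M.openProj U' * T * M.openProj U')
      linarith

theorem mul_openProj_mem_localizedRoe {T : ℋ →L[ℂ] ℋ} (hT : T ∈ M.roeAlgebra) (Y : Set X) :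
    T * M.openProj (Metric.thickening 1 Y) ∈ M.localizedRoe (.ofSet Y) :=
  M.mul_mem_localizedRoe_of hT one_pos (M.openProj_mul_self _) (M.openProj_mul_self _)
    fun _ hS => M.mul_openProj_mem_roe hS _

theorem mul_one_sub_mem_localizedRoe {T : ℋ →L[ℂ] ℋ} (hT : T ∈ M.roeAlgebra) (Y : Set X) :
    T * (1 - M.openProj (Metric.thickening 1 Y)) ∈ M.localizedRoe (.ofSet Yᶜ) := by
  have hcover : Metric.thickening 1 Yᶜ ∪ Metric.thickening 1 Y = Set.univ := by
    rw [Set.eq_univ_iff_forall]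
    intro x
    by_cases hx : x ∈ Y
    · exact .inr (Metric.self_subset_thickening one_pos _ hx)
    · exact .inl (Metric.self_subset_thickening one_pos _ hx)
  have h1 := M.one_sub_mul_one_sub Metric.isOpen_thickening Metric.isOpen_thickening hcover
  rw [sub_mul, one_mul, sub_eq_zero] at h1
  refine M.mul_mem_localizedRoe_of hT one_pos h1.symm ?_ ?_
  · have h2 := congrArg star h1
    rw [StarMul.star_mul (R := ℋ →L[ℂ] ℋ), star_sub, star_one, star_openProj,
      star_openProj] at h2
    exact h2.symm
  · intro S hS
    rw [mul_sub, mul_one]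
    exact sub_mem hS (M.mul_openProj_mem_roe hS _)

/-- The Roe algebra of `X` is decomposed by the ideals `C*_Roe({Y})` and `C*_Roe({X ∖ Y})`, whose
intersection is `C*_Roe(∂Y)`. -/
theorem isMayerVietoris (Y : Set X) :
    KTheory.IsMayerVietoris M.roeAlgebra (M.localizedRoe (.ofSet Y)) (M.localizedRoe (.ofSet Yᶜ))
      (M.localizedRoe (.coarseBoundary Y)) where
  left_le := M.localizedRoe_le _
  isClosed_left := inferInstance
  isClosed_right := inferInstance
  mul_mem_left _ ha _ hx := M.mul_mem_localizedRoe ha hx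
  mul_mem_right _ ha _ hx := M.mul_mem_localizedRoe ha hx
  mem_inter _ := M.mem_localizedRoe_coarseBoundary
  exists_split := by
    set P := M.openProj (Metric.thickening 1 Y) with hP
    have hPs : star P = P := M.star_openProj _
    let L : (ℋ →L[ℂ] ℋ) →L[ℂ] (ℋ →L[ℂ] ℋ) := (1 / 2 : ℂ) •
      (ContinuousLinearMap.mul ℂ (ℋ →L[ℂ] ℋ) P +
        (ContinuousLinearMap.mul ℂ (ℋ →L[ℂ] ℋ)).flip P)
    have hL : ∀ T, L T = (1 / 2 : ℂ) • (P * T + T * P) := fun T => rfl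
    refine ⟨L, fun T => ?_, fun T hT => ⟨?_, ?_⟩⟩
    · rw [hL, hL, star_smul, star_add, StarMul.star_mul (R := ℋ →L[ℂ] ℋ),
        StarMul.star_mul (R := ℋ →L[ℂ] ℋ), hPs, add_comm]
      congr 1
      simp
    · rw [hL]
      refine SMulMemClass.smul_mem _ (add_mem ?_ (M.mul_openProj_mem_localizedRoe hT Y))
      have := star_mem (M.mul_openProj_mem_localizedRoe (star_mem hT) Y)
      rwa [StarMul.star_mul (R := ℋ →L[ℂ] ℋ), star_star, ← hP, hPs] at this
    · have h1 := M.mul_one_sub_mem_localizedRoe hT Y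
      have h2 := star_mem (M.mul_one_sub_mem_localizedRoe (star_mem hT) Y)
      rw [StarMul.star_mul (R := ℋ →L[ℂ] ℋ), star_star, star_sub, star_one, ← hP, hPs] at h2
      have e : T - L T = (1 / 2 : ℂ) • ((1 - P) * T + T * (1 - P)) := by
        rw [hL, sub_mul, mul_sub, one_mul, mul_one]
        module
      rw [e]
      exact SMulMemClass.smul_mem _ (add_mem h2 h1)

/-- The coarse Mayer–Vietoris boundary map `∂ : K₀(C*_Roe(X)) → K₁(C*_Roe(∂Y))`. -/
def coarseBoundaryMap (Y : Set X) :
    KTheory.K0 M.roeAlgebra →+ KTheory.K1 (M.localizedRoe (.coarseBoundary Y)) :=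
  (M.isMayerVietoris Y).boundary

end MayerVietoris

end XModule

section hamiltonian

open Complex
open scoped ComplexOrder

/-- The bounded operator `R` is the inverse of `T - z`, for `T` a possibly unbounded operator. -/
def IsResolventAt (T : ℋ →ₗ.[ℂ] ℋ) (z : ℂ) (R : ℋ →L[ℂ] ℋ) : Prop :=
  (∀ v, ∃ h : R v ∈ T.domain, T ⟨R v, h⟩ - z • R v = v) ∧
    ∀ x : T.domain, R (T x - z • (x : ℋ)) = x

/-- The spectrum of a possibly unbounded operator. -/
def spec (T : ℋ →ₗ.[ℂ] ℋ) : Set ℂ := {z | ¬ ∃ R : ℋ →L[ℂ] ℋ, IsResolventAt T z R}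

open Classical in
/-- The resolvent `(T - z)⁻¹` (defined to be `0` if `z` is in the spectrum of `T`). -/
def resolvent (T : ℋ →ₗ.[ℂ] ℋ) (z : ℂ) : ℋ →L[ℂ] ℋ :=
  if h : ∃ R : ℋ →L[ℂ] ℋ, IsResolventAt T z R then h.choose else 0

/-- The functional calculus `f(H)` of a self-adjoint operator `H`. In terms of the bounded normal
operator `R = (H + i)⁻¹`, whose spectrum consists of the numbers `z = (t + i)⁻¹`, `t` in the
spectrum of `H` (and of `z = 0`, corresponding to `t = ∞`, if `H` is unbounded), it is `g(R)`, where
`g(z) = f(z⁻¹ - i)` and `g(0) = 0`. -/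
def fc (H : ℋ →ₗ.[ℂ] ℋ) (f : ℝ → ℂ) : ℋ →L[ℂ] ℋ :=
  cfc (fun z : ℂ => if z = 0 then 0 else f (z⁻¹ - I).re) (resolvent H (-I))

/-- The Fermi projection `p_E`, the spectral projection of `H` to the energies below `E`. -/
def fermiProjection (H : ℋ →ₗ.[ℂ] ℋ) (E : ℝ) : ℋ →L[ℂ] ℋ :=
  fc H ((Set.Iio E).indicator fun _ => 1)

/-- `H` is insulating at the energy `E` if `E` is not in its spectrum. -/
def IsInsulating (H : ℋ →ₗ.[ℂ] ℋ) (E : ℝ) : Prop := (E : ℂ) ∉ spec H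

/-- `H` is a Hamiltonian compatible with the Roe algebra: a positive self-adjoint operator such
that `f(H)` is in the Roe algebra for all `f ∈ C_c(ℝ)`. -/
structure IsCompatibleHamiltonian (M : XModule X ℋ) (H : ℋ →ₗ.[ℂ] ℋ) : Prop where
  isSelfAdjoint : IsSelfAdjoint H
  nonneg : ∀ x : H.domain, 0 ≤ (inner ℂ (x : ℋ) (H x)).re
  fc_mem : ∀ f : CompactlySupportedContinuousMap ℝ ℂ, fc H f ∈ M.roeAlgebra

/-- `Htilde` is a Hamiltonian on `Y` adapted to `H`: a self-adjoint operator, bounded from below,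
with `f(Htilde) ∈ C*_Roe({Y})` and `f(H) - f(Htilde) ∈ C*_Roe({X ∖ Y})` for all `f ∈ C₀(ℝ)`.
The operator acts on a Hilbert space `𝒦` embedded isometrically in `ℋ` (such as `ℋ` itself, or
`L²(Y)` inside `L²(X)`), and `f(Htilde)` is extended by zero to `ℋ`. -/
structure IsAdaptedHamiltonian (M : XModule X ℋ) (H : ℋ →ₗ.[ℂ] ℋ) (Y : Set X)
    {𝒦 : Type*} [NormedAddCommGroup 𝒦] [InnerProductSpace ℂ 𝒦] [CompleteSpace 𝒦]
    (j : 𝒦 →ₗᵢ[ℂ] ℋ) (Htilde : 𝒦 →ₗ.[ℂ] 𝒦) : Prop where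
  isSelfAdjoint : IsSelfAdjoint Htilde
  bddBelow : ∃ c : ℝ, ∀ x : Htilde.domain,
    c * ‖(x : 𝒦)‖ ^ 2 ≤ (inner ℂ (x : 𝒦) (Htilde x)).re
  fc_mem : ∀ f : C₀(ℝ, ℂ),
    j.toContinuousLinearMap ∘L fc Htilde f ∘L j.toContinuousLinearMap.adjoint ∈
      M.localizedRoe (.ofSet Y)
  sub_mem : ∀ f : C₀(ℝ, ℂ),
    fc H f - j.toContinuousLinearMap ∘L fc Htilde f ∘L j.toContinuousLinearMap.adjoint ∈
      M.localizedRoe (.ofSet Yᶜ)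

theorem isStarProjection_cfc {g : ℂ → ℂ} (hg : ∀ z, g z = 0 ∨ g z = 1) (R : ℋ →L[ℂ] ℋ) :
    IsStarProjection (cfc g R) := by
  by_cases hR : IsStarNormal R
  · by_cases hc : ContinuousOn g (spectrum ℂ R)
    · constructor
      · rw [IsIdempotentElem, ← cfc_mul g g R]
        congr 1
        ext z
        rcases hg z with h | h <;> simp [h]
      · rw [IsSelfAdjoint, ← cfc_star]
        congr 1
        ext z
        rcases hg z with h | h <;> simp [h]
    · rw [cfc_apply_of_not_continuousOn R hc]
      exact .zero _
  · rw [cfc_apply_of_not_predicate R hR]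
    exact .zero _

theorem isStarProjection_fermiProjection (H : ℋ →ₗ.[ℂ] ℋ) (E : ℝ) :
    IsStarProjection (fermiProjection H E) := by
  refine isStarProjection_cfc (fun z => ?_) _
  by_cases hz : z = 0
  · simp [hz]
  · by_cases h : (z⁻¹ - I).re ∈ Set.Iio E
    · right; rw [if_neg hz, Set.indicator_of_mem h]
    · left; rw [if_neg hz, Set.indicator_of_notMem h]

theorem notMem_spectrum_of_isResolventAt {H : ℋ →ₗ.[ℂ] ℋ} {R S : ℋ →L[ℂ] ℋ} {a b : ℂ}
    (hR : IsResolventAt H a R) (hS : IsResolventAt H b S) (hab : b - a ≠ 0) :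
    (b - a)⁻¹ ∉ spectrum ℂ R := by
  have hRS : ∀ v, R (v + (b - a) • S v) = S v := by
    intro v
    obtain ⟨h, e⟩ := hS.1 v
    refine Eq.trans (congrArg R ?_) (hR.2 ⟨S v, h⟩)
    change _ = H ⟨S v, h⟩ - a • S v
    nth_rewrite 1 [← e]
    module
  have hSR : ∀ v, S (v - (b - a) • R v) = R v := by
    intro v
    obtain ⟨h, e⟩ := hR.1 v
    refine Eq.trans (congrArg S ?_) (hS.2 ⟨R v, h⟩)
    change _ = H ⟨R v, h⟩ - b • R v
    nth_rewrite 1 [← e]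
    module
  rw [spectrum.notMem_iff]
  have e : algebraMap ℂ (ℋ →L[ℂ] ℋ) (b - a)⁻¹ - R = (b - a)⁻¹ • (1 - (b - a) • R) := by
    rw [smul_sub, smul_smul, inv_mul_cancel₀ hab, one_smul, Algebra.algebraMap_eq_smul_one]
  have hu : IsUnit (1 - (b - a) • R) := by
    refine ⟨⟨1 - (b - a) • R, 1 + (b - a) • S, ?_, ?_⟩, rfl⟩
    · ext v
      have := hRS v
      simp only [mul_apply_eq_comp, sub_apply, add_apply,
        smul_apply, one_apply_eq_self, this]
      abel
    · ext v
      have := hSR v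
      simp only [mul_apply_eq_comp, sub_apply, add_apply,
        smul_apply, one_apply_eq_self, this]
      abel
  rw [e]
  exact hu.smul (Units.mk0 (b - a)⁻¹ (inv_ne_zero hab))

theorem inner_comm_of_isSelfAdjoint {H : ℋ →ₗ.[ℂ] ℋ} (hH : IsSelfAdjoint H) (x : H.domain) :
    inner ℂ (H x) (x : ℋ) = inner ℂ (x : ℋ) (H x) := by
  have := LinearPMap.adjoint_isFormalAdjoint hH.dense_domain
  rw [LinearPMap.isSelfAdjoint_def.1 hH] at this
  exact this x x

/-- The spectrum of `(H + i)⁻¹` lies in the curve of all `(t + i)⁻¹`, `t ≥ 0`, if `H ≥ 0`. -/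
theorem mem_spectrum_resolvent {H : ℋ →ₗ.[ℂ] ℋ} (hH : IsSelfAdjoint H)
    (hpos : ∀ x : H.domain, 0 ≤ (inner ℂ (x : ℋ) (H x)).re) {R : ℋ →L[ℂ] ℋ}
    (hR : IsResolventAt H (-I) R) (hn : IsStarNormal R) {z : ℂ} (hz : z ∈ spectrum ℂ R)
    (hz0 : z ≠ 0) : 0 ≤ (z⁻¹ - I).re ∧ z⁻¹ = (((z⁻¹ - I).re : ℝ) : ℂ) + I := by
  have key : ∀ v, (inner ℂ (R v) v).im = ‖R v‖ ^ 2 ∧ 0 ≤ (inner ℂ (R v) v).re := by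
    intro v
    obtain ⟨h, e⟩ := hR.1 v
    have him : (inner ℂ (R v) (H ⟨R v, h⟩)).im = 0 := by
      have := inner_comm_of_isSelfAdjoint hH ⟨R v, h⟩
      have h2 := inner_conj_symm (𝕜 := ℂ) (R v) (H ⟨R v, h⟩)
      change inner ℂ (H ⟨R v, h⟩) (R v) = inner ℂ (R v) (H ⟨R v, h⟩) at this
      rw [this] at h2
      exact Complex.conj_eq_iff_im.1 h2
    have hre := hpos ⟨R v, h⟩
    change 0 ≤ (inner ℂ (R v) (H ⟨R v, h⟩)).re at hre
    have e2 : inner ℂ (R v) v = inner ℂ (R v) (H ⟨R v, h⟩) + I * ((‖R v‖ ^ 2 : ℝ) : ℂ) := by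
      nth_rewrite 2 [← e]
      rw [inner_sub_right, inner_smul_right, inner_self_eq_norm_sq_to_K]
      push_cast
      simp
    rw [e2]
    constructor
    · rw [add_im, him, I_mul_im, ofReal_re, zero_add]
    · rw [add_re, I_mul_re, ofReal_im, neg_zero, add_zero]; exact hre
  have h1 : R - star R = (-2 * I) • (star R * R) := by
    refine ContinuousLinearMap.coe_injective ((ext_inner_map _ _).1 fun v => ?_)
    change inner ℂ ((R - star R) v) v = inner ℂ (((-2 * I) • (star R * R)) v) v
    rw [sub_apply, smul_apply, mul_apply_eq_comp,
      ContinuousLinearMap.star_eq_adjoint, inner_sub_left, inner_smul_left,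
      ContinuousLinearMap.adjoint_inner_left, ContinuousLinearMap.adjoint_inner_left,
      inner_self_eq_norm_sq_to_K]
    have := (key v).1
    have hs : inner ℂ v (R v) = star (inner ℂ (R v) v) := (inner_conj_symm v (R v)).symm
    rw [hs]
    generalize inner ℂ (R v) v = c at this
    apply Complex.ext
    · simp [← ofReal_pow]
    · simp [← ofReal_pow, this]; ring
  have h2 : 0 ≤ R + star R := by
    rw [ContinuousLinearMap.nonneg_iff_isPositive]
    refine (ContinuousLinearMap.isPositive_iff_complex _).2 fun v => ?_
    have e : inner ℂ ((R + star R) v) v = ((2 * (inner ℂ (R v) v).re : ℝ) : ℂ) := by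
      rw [add_apply, ContinuousLinearMap.star_eq_adjoint, inner_add_left,
        ContinuousLinearMap.adjoint_inner_left, ← inner_conj_symm v (R v), Complex.add_conj]
    rw [e]
    have := (key v).2
    exact ⟨by simp, by simpa using this⟩
  have hid : cfc (fun w : ℂ => w) R = R := cfc_id' ℂ R
  have hst : cfc (fun w : ℂ => star w) R = star R := cfc_star_id R
  have e1 : cfc (fun w : ℂ => w - star w) R = cfc (fun w : ℂ => (-2 * I) * (star w * w)) R := by
    rw [cfc_sub (fun w : ℂ => w) (fun w => star w) R, hid, hst,
      cfc_const_mul (-2 * I) (fun w : ℂ => star w * w) R,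
      cfc_mul (fun w : ℂ => star w) (fun w => w) R, hid, hst, h1]
  have e2 : 0 ≤ cfc (fun w : ℂ => w + star w) R := by
    rw [cfc_add R (fun w : ℂ => w) (fun w => star w), hid, hst]
    exact h2
  have f1 : z - star z = (-2 * I) * (star z * z) :=
    (by exact eqOn_of_cfc_eq_cfc e1 : Set.EqOn (fun w : ℂ => w - star w)
      (fun w : ℂ => (-2 * I) * (star w * w)) (spectrum ℂ R)) hz
  have f2 : 0 ≤ z + star z := (cfc_nonneg_iff (fun w : ℂ => w + star w) R).1 e2 z hz
  have g1 : z.im = -normSq z := by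
    have := congrArg Complex.im f1
    rw [Complex.star_def, ← normSq_eq_conj_mul_self] at this
    simp at this
    linarith
  have g2 : 0 ≤ z.re := by
    have := (Complex.le_def.1 f2).1
    simp at this
    linarith
  have hns : 0 < normSq z := normSq_pos.2 hz0
  constructor
  · rw [sub_re, I_re, sub_zero, inv_re]
    positivity
  · apply Complex.ext
    · simp
    · rw [inv_im, g1]
      simp [hns.ne']

/-- The Fermi projection of a Hamiltonian in a spectral gap lies in the Roe algebra. -/
theorem IsCompatibleHamiltonian.fermiProjection_mem {M : XModule X ℋ} {H : ℋ →ₗ.[ℂ] ℋ}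
    (hH : IsCompatibleHamiltonian M H) {E : ℝ} (hE : IsInsulating H E) :
    fermiProjection H E ∈ M.roeAlgebra := by
  by_cases hex : ∃ R : ℋ →L[ℂ] ℋ, IsResolventAt H (-I) R
  · by_cases hn : IsStarNormal (resolvent H (-I))
    · have hR : IsResolventAt H (-I) (resolvent H (-I)) := by
        rw [resolvent, dif_pos hex]; exact hex.choose_spec
      obtain ⟨S, hS⟩ := not_not.1 hE
      have hne : ∀ t : ℝ, (t : ℂ) - -I ≠ 0 := fun t h => by
        have := congrArg Complex.im h
        simp at this
      have hgap := notMem_spectrum_of_isResolventAt hR hS (hne E)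
      have hcont : Continuous fun t : ℝ => ((t : ℂ) - -I)⁻¹ := by
        refine Continuous.inv₀ (by fun_prop) hne
      have hopen : IsOpen {t : ℝ | ((t : ℂ) - -I)⁻¹ ∉ spectrum ℂ (resolvent H (-I))} :=
        (spectrum.isClosed (resolvent H (-I))).isOpen_compl.preimage hcont
      obtain ⟨δ, hδ, hball⟩ := Metric.isOpen_iff.1 hopen E hgap
      let h : ℝ → ℝ := fun t => max 0 (min 1 (min (t + 1) ((E + δ - t) / (2 * δ))))
      have hhc : Continuous h := by
        have : Continuous fun t : ℝ => (E + δ - t) / (2 * δ) := by fun_prop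
        exact continuous_const.max (continuous_const.min ((continuous_id.add_const 1).min this))
      let hf : CompactlySupportedContinuousMap ℝ ℂ :=
        { toFun := fun t => (h t : ℂ)
          continuous_toFun := continuous_ofReal.comp hhc
          hasCompactSupport' := by
            refine HasCompactSupport.intro (isCompact_Icc (a := (-1 : ℝ)) (b := E + δ)) ?_
            intro t ht
            have : h t = 0 := by
              rw [Set.mem_Icc, not_and_or, not_le, not_le] at ht
              refine max_eq_left ?_
              rcases ht with ht | ht
              · exact (min_le_right _ _).trans ((min_le_left _ _).trans (by linarith))
              · refine (min_le_right _ _).trans ((min_le_right _ _).trans ?_)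
                exact div_nonpos_of_nonpos_of_nonneg (by linarith) (by linarith)
            rw [this, ofReal_zero] }
      have heq : fermiProjection H E = fc H hf := by
        refine cfc_congr fun z hz => ?_
        by_cases hz0 : z = 0
        · simp only [hz0, if_true]
        · simp only [hz0, if_false]
          obtain ⟨hp, hzt⟩ := mem_spectrum_resolvent hH.isSelfAdjoint hH.nonneg hR hn hz hz0
          set t := (z⁻¹ - I).re
          have hzz : ((t : ℂ) - -I)⁻¹ = z := by rw [sub_neg_eq_add, ← hzt, inv_inv]
          have hfar : δ ≤ |t - E| := by
            by_contra! hlt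
            refine hball (a := t) (by rwa [Metric.mem_ball, Real.dist_eq]) ?_
            rwa [hzz]
          change _ = (h t : ℂ)
          by_cases ht : t < E
          · rw [Set.indicator_of_mem (show t ∈ Set.Iio E from ht)]
            rw [abs_of_neg (by linarith)] at hfar
            have : h t = 1 := by
              have h3 : 1 ≤ (E + δ - t) / (2 * δ) := by
                rw [le_div_iff₀ (by linarith)]; linarith
              change max 0 (min 1 (min (t + 1) ((E + δ - t) / (2 * δ)))) = 1
              rw [min_eq_left (le_min (by linarith) h3), max_eq_right zero_le_one]
            rw [this, ofReal_one]
          · rw [Set.indicator_of_notMem (show t ∉ Set.Iio E from ht)]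
            rw [abs_of_nonneg (by linarith)] at hfar
            have : h t = 0 := by
              refine max_eq_left ((min_le_right _ _).trans ((min_le_right _ _).trans ?_))
              exact div_nonpos_of_nonpos_of_nonneg (by linarith) (by linarith)
            rw [this, ofReal_zero]
      rw [heq]
      exact hH.fc_mem hf
    · rw [fermiProjection, fc, cfc_apply_of_not_predicate _ hn]
      exact zero_mem _
  · have h0 : resolvent H (-I) = 0 := by rw [resolvent, dif_neg hex]
    have : fermiProjection H E = 0 := by
      rw [fermiProjection, fc, h0]
      refine Eq.trans (cfc_congr (g := 0) fun z hz => ?_) (cfc_zero ℂ (0 : ℋ →L[ℂ] ℋ))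
      have hz0 : z = 0 := by
        have := spectrum.norm_le_norm_mul_of_mem hz
        simpa using this
      simp [hz0]
    rw [this]
    exact zero_mem _

/-- The class `[p_E] ∈ K₀(C*_Roe(X))` of the Fermi projection of a Hamiltonian `H` which is
insulating at `E`. -/
def fermiClass {M : XModule X ℋ} {H : ℋ →ₗ.[ℂ] ℋ} (hH : IsCompatibleHamiltonian M H) {E : ℝ}
    (hE : IsInsulating H E) : KTheory.K0 M.roeAlgebra :=
  KTheory.K0.ofProjection (⟨fermiProjection H E, hH.fermiProjection_mem hE⟩ : M.roeAlgebra)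
    ⟨Subtype.ext (isStarProjection_fermiProjection H E).isIdempotentElem.eq,
      Subtype.ext (isStarProjection_fermiProjection H E).isSelfAdjoint.star_eq⟩

end hamiltonian

end Coarse

end

/-! ### The boundary map on a projection that admits a projection as lift. -/

namespace KTheory

namespace IsMayerVietoris

variable {𝔅 : Type*} [CStarAlgebra 𝔅] {A I J C : NonUnitalStarSubalgebra ℂ 𝔅}
  [IsClosed (A : Set 𝔅)] [IsClosed (C : Set 𝔅)]

/-! Write `I`, `J` and `C` for the localized Roe algebras of `{Y}`, `{X ∖ Y}` and `∂Y`. The boundary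
map measures the obstruction to moving a projection into `I` without changing it modulo `J`: it
sends `[p]` to the class of `exp(2πi a)`, where `a` is any self-adjoint element over `I⁺` that
agrees with `p` modulo `J`. This class does not depend on the choice of `a`. If some lift `a` is
itself a projection, then `exp(2πi a) = 1` and the boundary of `[p]` vanishes. This is the whole
K-theoretic input, contained in `expClass_eq_zero_of_isLift` and `boundary_ofProjection_eq_zero`.

The theorem follows by contraposition: if `E` is outside the spectrum of `Htilde`, the Fermi
projection of `Htilde`, extended by zero to `ℋ`, is such a lift of `p_E`. The adaptedness hypothesis
relates `f(H)` and `f(Htilde)` only for `f ∈ C₀(ℝ)`, and the indicator function of `(-∞, E)` is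
neither continuous nor zero at `-∞`. Both defects are harmless here. The spectra of both operators
leave a common gap around `E` (`IsInsulating.exists_gap`), inside which the jump can be replaced by
a continuous ramp. Both operators are bounded below, so the function may also be cut off to the left
of the two spectra. The result is a single `f ∈ C₀(ℝ)` (`exists_cutoff`) that agrees with the
indicator on both spectra, whence `f(H)` and `f(Htilde)` are the two Fermi projections
(`fc_eq_fermiProjection`). Adaptedness applied to this `f` places the second one in `I` and the
difference in `J`.

The functional calculus of an unbounded operator `T` is defined through the bounded operator `R = (T
+ i)⁻¹`. Gaps and lower bounds of `T` must therefore be expressed on the curve of points `(t +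
i)⁻¹`, with `0` playing the role of `t = ∞`. The key fact is `mem_spectrum_resolvent_of_le`, which
locates the nonzero spectrum of `R` on the part of this curve with `t ≥ c`. -/

theorem expClass_eq_zero_of_isLift {ι : Type} [Fintype ι] [DecidableEq ι]
    (h : IsMayerVietoris A I J C) {p a : Matrix ι ι (Unitization ℂ A)} (hp : IsStarProjection p)
    (ha : IsIdempotentElem a) (hpa : IsLift A I J p a) : h.expClass p hp = 0 := by
  -- By homotopy invariance any lift may be used to compute the class. The lift `a` is used, with
  -- the identity matrix over `C⁺` as the unitary representing its exponential.
  rw [h.expClass_eq hp (one_mem _) ⟨a, hpa, fun i j => ?_⟩, UnitalK1.mk_one]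
  rw [matrix_exp_idempotent a ha]
  -- Only the identity matrices over `C⁺` and `A⁺` remain to be compared: both have entries with
  -- scalar part `0` or `1` and vanishing algebra part.
  by_cases hij : i = j
  · subst hij; simp
  · simp [hij]

/-- A projection of `A` itself already has scalar part zero, so its K₀-class is a generator of the
Grothendieck group rather than a formal difference. The extension of `expV` to that group restricts
to `expV` on generators, and `expV` is computed by `expClass`. -/
theorem boundary_ofProjection (h : IsMayerVietoris A I J C) (p : A) (hp : IsStarProjection p) :
    h.boundary (K0.ofProjection p hp) = h.expClass _ (isStarProjection_inr hp) :=
  DFunLike.congr_fun (Algebra.GrothendieckAddGroup.lift.symm_apply_apply h.expV)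
    (V.mk _ (isStarProjection_inr hp))

/-- The boundary of the class of a projection `p` vanishes if `p` agrees modulo `J` with a
projection in `I`. -/
theorem boundary_ofProjection_eq_zero (h : IsMayerVietoris A I J C) {p q : A}
    (hp : IsStarProjection p) (hq : IsStarProjection q) (hqI : (q : 𝔅) ∈ I)
    (hqp : (p : 𝔅) - q ∈ J) : h.boundary (K0.ofProjection p hp) = 0 := by
  rw [h.boundary_ofProjection]
  -- The lift is the 1×1 matrix with entry `q`; its scalar part vanishes, as does that of `p`.
  refine h.expClass_eq_zero_of_isLift _ (isStarProjection_inr hq).isIdempotentElem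
    ⟨(isStarProjection_inr hq).isSelfAdjoint, fun i j => ⟨by simp, by simpa using hqI, ?_⟩⟩
  -- `IsLift` asks for lift minus projection, that is `q - p`, which is the negative of the given
  -- element of `J`.
  simpa using neg_mem hqp

end IsMayerVietoris

end KTheory

/-! ### Spectra, gaps and functional calculus of semibounded operators, via `(T + i)⁻¹`. -/

namespace Coarse

open Complex
open scoped ComplexOrder ZeroAtInfty

variable {ℋ : Type*} [NormedAddCommGroup ℋ] [InnerProductSpace ℂ ℋ] [CompleteSpace ℋ]

/-- The spectrum of `(T + i)⁻¹` lies in the curve of all `(t + i)⁻¹`, `t ≥ c`, if `T ≥ c`. -/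
theorem mem_spectrum_resolvent_of_le {T : ℋ →ₗ.[ℂ] ℋ} (hT : IsSelfAdjoint T) {c : ℝ}
    (hc : ∀ x : T.domain, c * ‖(x : ℋ)‖ ^ 2 ≤ (inner ℂ (x : ℋ) (T x)).re) {R : ℋ →L[ℂ] ℋ}
    (hR : IsResolventAt T (-I) R) (hn : IsStarNormal R) {z : ℂ} (hz : z ∈ spectrum ℂ R)
    (hz0 : z ≠ 0) : c ≤ (z⁻¹ - I).re ∧ z⁻¹ = (((z⁻¹ - I).re : ℝ) : ℂ) + I := by
  -- Put `v = (T + i) R v` into the second slot of the inner product with `R v`. Symmetry of `T`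
  -- makes the term with `T` real, so the imaginary part comes only from `i`; the lower bound of `T`
  -- controls the real part.
  have key : ∀ v, (inner ℂ (R v) v).im = ‖R v‖ ^ 2 ∧ c * ‖R v‖ ^ 2 ≤ (inner ℂ (R v) v).re := by
    intro v
    obtain ⟨h, e⟩ := hR.1 v
    have him : (inner ℂ (R v) (T ⟨R v, h⟩)).im = 0 := by
      have := inner_comm_of_isSelfAdjoint hT ⟨R v, h⟩
      have h2 := inner_conj_symm (𝕜 := ℂ) (R v) (T ⟨R v, h⟩)
      change inner ℂ (T ⟨R v, h⟩) (R v) = inner ℂ (R v) (T ⟨R v, h⟩) at this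
      rw [this] at h2
      exact Complex.conj_eq_iff_im.1 h2
    have hre := hc ⟨R v, h⟩
    change c * ‖R v‖ ^ 2 ≤ (inner ℂ (R v) (T ⟨R v, h⟩)).re at hre
    have e2 : inner ℂ (R v) v = inner ℂ (R v) (T ⟨R v, h⟩) + I * ((‖R v‖ ^ 2 : ℝ) : ℂ) := by
      nth_rewrite 2 [← e]
      rw [inner_sub_right, inner_smul_right, inner_self_eq_norm_sq_to_K]
      push_cast
      simp
    rw [e2]
    constructor
    · rw [add_im, him, I_mul_im, ofReal_re, zero_add]
    · rw [add_re, I_mul_re, ofReal_im, neg_zero, add_zero]; exact hre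
  -- This is the imaginary part of `key` in operator form. On a complex Hilbert space an operator is
  -- determined by its quadratic form, so it suffices to compare inner products with `v`. The scalar
  -- `-2i` is conjugated on leaving the first slot and becomes `2i`.
  have h1 : R - star R = (-2 * I) • (star R * R) := by
    refine ContinuousLinearMap.coe_injective ((ext_inner_map _ _).1 fun v => ?_)
    change inner ℂ ((R - star R) v) v = inner ℂ (((-2 * I) • (star R * R)) v) v
    rw [sub_apply, smul_apply, mul_apply_eq_comp,
      ContinuousLinearMap.star_eq_adjoint, inner_sub_left, inner_smul_left,
      ContinuousLinearMap.adjoint_inner_left, ContinuousLinearMap.adjoint_inner_left,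
      inner_self_eq_norm_sq_to_K]
    have := (key v).1
    have hs : inner ℂ v (R v) = star (inner ℂ (R v) v) := (inner_conj_symm v (R v)).symm
    rw [hs]
    generalize inner ℂ (R v) v = c at this
    apply Complex.ext
    · simp [← ofReal_pow]
    · simp [← ofReal_pow, this]; ring
  -- The real part of `key` in operator form: the quadratic form is twice `Re ⟨R v, v⟩ - c ‖R v‖²`.
  -- The term in `c` is what distinguishes a general lower bound from positivity.
  have h2 : 0 ≤ R + star R - (2 * c : ℂ) • (star R * R) := by
    rw [ContinuousLinearMap.nonneg_iff_isPositive]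
    refine (ContinuousLinearMap.isPositive_iff_complex _).2 fun v => ?_
    have e : inner ℂ ((R + star R - (2 * c : ℂ) • (star R * R)) v) v =
        ((2 * ((inner ℂ (R v) v).re - c * ‖R v‖ ^ 2) : ℝ) : ℂ) := by
      rw [sub_apply, add_apply, smul_apply, mul_apply_eq_comp,
        ContinuousLinearMap.star_eq_adjoint, inner_sub_left, inner_add_left, inner_smul_left,
        ContinuousLinearMap.adjoint_inner_left, ContinuousLinearMap.adjoint_inner_left,
        ← inner_conj_symm v (R v), Complex.add_conj, inner_self_eq_norm_sq_to_K]
      have h2c : (starRingEnd ℂ) (2 * c : ℂ) = 2 * c := by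
        rw [← ofReal_ofNat, ← ofReal_mul, conj_ofReal]
      rw [h2c]
      push_cast
      rw [mul_sub, ← mul_assoc]
      rfl
    rw [e]
    have := (key v).2
    refine ⟨rfl, ?_⟩
    change 0 ≤ 2 * ((inner ℂ (R v) v).re - c * ‖R v‖ ^ 2)
    linarith
  -- As `R` is normal, both operator relations are relations between continuous functions of `R`. An
  -- equality or a positivity statement in the functional calculus holds pointwise on the spectrum,
  -- so `R` and `star R` may be replaced by `z` and its conjugate.
  have hid : cfc (fun w : ℂ => w) R = R := cfc_id' ℂ R
  have hst : cfc (fun w : ℂ => star w) R = star R := cfc_star_id R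
  have hsq : cfc (fun w : ℂ => star w * w) R = star R * R := by
    rw [cfc_mul (fun w : ℂ => star w) (fun w => w) R, hid, hst]
  have e1 : cfc (fun w : ℂ => w - star w) R = cfc (fun w : ℂ => (-2 * I) * (star w * w)) R := by
    rw [cfc_sub (fun w : ℂ => w) (fun w => star w) R, hid, hst,
      cfc_const_mul (-2 * I) (fun w : ℂ => star w * w) R, hsq, h1]
  have e2 : 0 ≤ cfc (fun w : ℂ => w + star w - (2 * c : ℂ) * (star w * w)) R := by
    rw [cfc_sub (fun w : ℂ => w + star w) (fun w => (2 * c : ℂ) * (star w * w)) R,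
      cfc_add R (fun w : ℂ => w) (fun w => star w), hid, hst,
      cfc_const_mul (2 * c : ℂ) (fun w : ℂ => star w * w) R, hsq]
    exact h2
  have f1 : z - star z = (-2 * I) * (star z * z) :=
    (by exact eqOn_of_cfc_eq_cfc e1 : Set.EqOn (fun w : ℂ => w - star w)
      (fun w : ℂ => (-2 * I) * (star w * w)) (spectrum ℂ R)) hz
  have f2 : 0 ≤ z + star z - (2 * c : ℂ) * (star z * z) :=
    (cfc_nonneg_iff (fun w : ℂ => w + star w - (2 * c : ℂ) * (star w * w)) R).1 e2 z hz
  rw [Complex.star_def, ← normSq_eq_conj_mul_self] at f1 f2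
  -- The spectral equation reads `2i Im z = -2i |z|²`, so `z` lies on the circle that inversion
  -- turns into the line `Im = 1`.
  have g1 : z.im = -normSq z := by
    have := congrArg Complex.im f1
    simp at this
    linarith
  have g2 : c * normSq z ≤ z.re := by
    have := (Complex.le_def.1 f2).1
    simp at this
    linarith
  have hns : 0 < normSq z := normSq_pos.2 hz0
  -- Since `z⁻¹` is the conjugate of `z` divided by `|z|²`, dividing `g1` and `g2` by `|z|² > 0`
  -- gives imaginary part `1` and real part at least `c`.
  constructor
  · rw [sub_re, I_re, sub_zero, inv_re, le_div_iff₀ hns]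
    exact g2
  · apply Complex.ext
    · simp
    · rw [inv_im, g1]
      simp [hns.ne']

/-- The value of `resolvent` at a spectral point is `0` by convention, so a nonzero value certifies
a true inverse. With `ne_zero_of_mem_spectrum`, a nonzero point in the spectrum of `resolvent T
(-I)` is enough evidence that this operator really inverts `T + i`. No separate existence argument
is then needed. -/
theorem isResolventAt_resolvent {ℋ : Type*} [NormedAddCommGroup ℋ] [InnerProductSpace ℂ ℋ]
    {T : ℋ →ₗ.[ℂ] ℋ} {z : ℂ} (h : resolvent T z ≠ 0) :
    IsResolventAt T z (resolvent T z) := by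
  by_cases hex : ∃ R : ℋ →L[ℂ] ℋ, IsResolventAt T z R
  · rw [resolvent, dif_pos hex]; exact hex.choose_spec
  · exact absurd (by rw [resolvent, dif_neg hex]) h

theorem ne_zero_of_mem_spectrum {R : ℋ →L[ℂ] ℋ} {z : ℂ} (hz : z ∈ spectrum ℂ R) (hz0 : z ≠ 0) :
    R ≠ 0 := by
  rintro rfl
  -- The bound `‖z‖ ≤ ‖0‖ * ‖1‖` forces `z = 0`; it also covers the zero Hilbert space.
  exact hz0 (by simpa using spectrum.norm_le_norm_mul_of_mem hz)

/-- Off the spectrum of `T` there is a spectral gap, expressed in terms of `(T + i)⁻¹`. -/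
theorem IsInsulating.exists_gap {T : ℋ →ₗ.[ℂ] ℋ} {E : ℝ} (hE : IsInsulating T E) :
    ∃ δ > 0, ∀ t : ℝ, |t - E| < δ → ((t : ℂ) + I)⁻¹ ∉ spectrum ℂ (resolvent T (-I)) := by
  have hne : ∀ t : ℝ, (t : ℂ) + I ≠ 0 := fun t h => by
    have := congrArg Complex.im h
    simp at this
  obtain ⟨S, hS⟩ := not_not.1 hE
  -- A point `(E + i)⁻¹` in the spectrum would make the resolvent nonzero, hence genuine. Then the
  -- bounded inverse `S` of `T - E` excludes this very point from the spectrum of `(T + i)⁻¹`.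
  have hgap : ((E : ℂ) + I)⁻¹ ∉ spectrum ℂ (resolvent T (-I)) := fun hmem => by
    have hR := isResolventAt_resolvent (ne_zero_of_mem_spectrum hmem (inv_ne_zero (hne E)))
    refine notMem_spectrum_of_isResolventAt hR hS ?_ ?_
    · rw [sub_neg_eq_add]; exact hne E
    · rwa [sub_neg_eq_add]
  have hcont : Continuous fun t : ℝ => ((t : ℂ) + I)⁻¹ := Continuous.inv₀ (by fun_prop) hne
  -- The spectrum of the bounded operator is closed, so its complement pulls back along `t ↦ (t +
  -- i)⁻¹` to an open set containing `E`; a ball in it is the gap.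
  have hopen : IsOpen {t : ℝ | ((t : ℂ) + I)⁻¹ ∉ spectrum ℂ (resolvent T (-I))} :=
    (spectrum.isClosed (resolvent T (-I))).isOpen_compl.preimage hcont
  obtain ⟨δ, hδ, hball⟩ := Metric.isOpen_iff.1 hopen E hgap
  exact ⟨δ, hδ, fun t ht => hball (by rwa [Metric.mem_ball, Real.dist_eq])⟩

/-- A function which is `1` on the part of the spectrum below a gap and `0` on the part above it
computes the Fermi projection. -/
theorem fc_eq_fermiProjection {T : ℋ →ₗ.[ℂ] ℋ} (hT : IsSelfAdjoint T) {c : ℝ}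
    (hc : ∀ x : T.domain, c * ‖(x : ℋ)‖ ^ 2 ≤ (inner ℂ (x : ℋ) (T x)).re) {E δ : ℝ}
    (hgap : ∀ t : ℝ, |t - E| < δ → ((t : ℂ) + I)⁻¹ ∉ spectrum ℂ (resolvent T (-I))) {f : ℝ → ℂ}
    (hf1 : ∀ t, c ≤ t → t ≤ E - δ → f t = 1) (hf0 : ∀ t, E + δ ≤ t → f t = 0) :
    fc T f = fermiProjection T E := by
  by_cases hn : IsStarNormal (resolvent T (-I))
  · refine cfc_congr fun z hz => ?_
    -- The point `0` stands for `t = ∞`, where `fc` assigns the value `0` whatever the function is.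
    by_cases hz0 : z = 0
    · simp only [hz0, if_true]
    simp only [hz0, if_false]
    obtain ⟨hct, hzt⟩ := mem_spectrum_resolvent_of_le hT hc
      (isResolventAt_resolvent (ne_zero_of_mem_spectrum hz hz0)) hn hz hz0
    set t := (z⁻¹ - I).re
    -- The point `z` equals `(t + i)⁻¹` and is in the spectrum, so `t` cannot lie in the gap. It is
    -- therefore in `[c, E - δ]` or in `[E + δ, ∞)`, the two ranges where `f` is prescribed.
    have hfar : δ ≤ |t - E| := by
      by_contra! hlt
      refine hgap t hlt ?_
      rwa [← hzt, inv_inv]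
    by_cases ht : t < E
    · rw [Set.indicator_of_mem (show t ∈ Set.Iio E from ht)]
      rw [abs_of_neg (by linarith)] at hfar
      exact hf1 t hct (by linarith)
    · rw [Set.indicator_of_notMem (show t ∉ Set.Iio E from ht)]
      rw [abs_of_nonneg (by linarith)] at hfar
      exact hf0 t (by linarith)
  -- If `R` were not normal, `cfc` would take its default value `0` on both sides.
  · rw [fermiProjection, fc, fc, cfc_apply_of_not_predicate _ hn, cfc_apply_of_not_predicate _ hn]

/-- A continuous trapezoid does this. The descending side fits into the gap around `E`, and the
ascending side lies to the left of `c`. The latter is where semiboundedness enters: a function equal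
to `1` on all of `(-∞, E - δ]` would not vanish at infinity. -/
theorem exists_cutoff (c E : ℝ) {δ : ℝ} (hδ : 0 < δ) : ∃ f : C₀(ℝ, ℂ),
    (∀ t, c ≤ t → t ≤ E - δ → f t = 1) ∧ ∀ t, E + δ ≤ t → f t = 0 := by
  -- The first ramp `t - c + 1` rises from `0` at `c - 1` to `1` at `c`. The second has slope `-1 /
  -- (2δ)` and falls from `1` at `E - δ` to `0` at `E + δ`.
  let h : ℝ → ℝ := fun t => max 0 (min 1 (min (t - c + 1) ((E + δ - t) / (2 * δ))))
  have hhc : Continuous h := by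
    have : Continuous fun t : ℝ => (E + δ - t) / (2 * δ) := by fun_prop
    exact continuous_const.max
      (continuous_const.min (((continuous_id.sub continuous_const).add_const 1).min this))
  have hright : ∀ t, E + δ ≤ t → h t = 0 := fun t ht =>
    max_eq_left ((min_le_right _ _).trans ((min_le_right _ _).trans
      (div_nonpos_of_nonpos_of_nonneg (by linarith) (by linarith))))
  have hleft : ∀ t, t ≤ c - 1 → h t = 0 := fun t ht =>
    max_eq_left ((min_le_right _ _).trans ((min_le_left _ _).trans (by linarith)))
  -- Vanishing at infinity is obtained from vanishing outside `[c - 1, E + δ]`. If this interval is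
  -- empty, `h` is identically zero, and the range `c ≤ t ≤ E - δ` is empty too.
  have hsupp : HasCompactSupport fun t => (h t : ℂ) := by
    refine HasCompactSupport.intro (isCompact_Icc (a := c - 1) (b := E + δ)) fun t ht => ?_
    rw [Set.mem_Icc, not_and_or, not_le, not_le] at ht
    rcases ht with ht | ht
    · rw [hleft t ht.le, ofReal_zero]
    · rw [hright t ht.le, ofReal_zero]
  refine ⟨⟨⟨fun t => (h t : ℂ), continuous_ofReal.comp hhc⟩, hsupp.is_zero_at_infty⟩, ?_, ?_⟩
  · intro t hct ht
    have h3 : 1 ≤ (E + δ - t) / (2 * δ) := by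
      rw [le_div_iff₀ (by linarith)]; linarith
    have : h t = 1 := by
      change max 0 (min 1 (min (t - c + 1) ((E + δ - t) / (2 * δ)))) = 1
      rw [min_eq_left (le_min (by linarith) h3), max_eq_right zero_le_one]
    change (h t : ℂ) = 1
    rw [this, ofReal_one]
  · intro t ht
    change (h t : ℂ) = 0
    rw [hright t ht, ofReal_zero]

/-- The extension by zero of a projection along an isometry is a projection. -/
theorem isStarProjection_extend {𝒦 : Type*} [NormedAddCommGroup 𝒦] [InnerProductSpace ℂ 𝒦]
    [CompleteSpace 𝒦] (j : 𝒦 →ₗᵢ[ℂ] ℋ) {q : 𝒦 →L[ℂ] 𝒦} (hq : IsStarProjection q) :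
    IsStarProjection (j.toContinuousLinearMap ∘L q ∘L j.toContinuousLinearMap.adjoint) := by
  -- An isometry satisfies `j* j = 1`, so the inner factors cancel in `(j q j*)(j q j*) = j q² j*`.
  have hj : ∀ v, j.toContinuousLinearMap.adjoint (j v) = v := fun v =>
    DFunLike.congr_fun
      ((ContinuousLinearMap.norm_map_iff_adjoint_comp_self j.toContinuousLinearMap).1 j.norm_map) v
  refine ⟨?_, ?_⟩
  · ext v
    have := DFunLike.congr_fun hq.isIdempotentElem.eq (j.toContinuousLinearMap.adjoint v)
    rw [mul_apply_eq_comp] at this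
    simp [mul_apply_eq_comp, hj, this]
  · have := hq.isSelfAdjoint.star_eq
    rw [ContinuousLinearMap.star_eq_adjoint] at this
    rw [IsSelfAdjoint, ContinuousLinearMap.star_eq_adjoint, ContinuousLinearMap.adjoint_comp,
      ContinuousLinearMap.adjoint_comp, ContinuousLinearMap.adjoint_adjoint, this,
      ContinuousLinearMap.comp_assoc]

end Coarse

/-! ### From a nonzero boundary class to spectrum of the adapted Hamiltonian. -/

theorem mainTheorem1 {X : Type*} [MetricSpace X]
    {ℋ : Type*} [NormedAddCommGroup ℋ] [InnerProductSpace ℂ ℋ] [CompleteSpace ℋ]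
    (M : Coarse.XModule X ℋ) (hM : M.IsAmple)
    (H : ℋ →ₗ.[ℂ] ℋ) (hH : Coarse.IsCompatibleHamiltonian M H)
    (Y : Set X)
    {𝒦 : Type*} [NormedAddCommGroup 𝒦] [InnerProductSpace ℂ 𝒦] [CompleteSpace 𝒦]
    (j : 𝒦 →ₗᵢ[ℂ] ℋ) (Htilde : 𝒦 →ₗ.[ℂ] 𝒦)
    (hHtilde : Coarse.IsAdaptedHamiltonian M H Y j Htilde)
    (E : ℝ) (hE : Coarse.IsInsulating H E)
    (hne : M.coarseBoundaryMap Y (Coarse.fermiClass hH hE) ≠ 0) :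
    (E : ℂ) ∈ Coarse.spec Htilde := by
  by_contra hE'
  obtain ⟨c, hc⟩ := hHtilde.bddBelow
  obtain ⟨δ₁, hδ₁, hgap₁⟩ := hE.exists_gap
  -- The assumption to be refuted says precisely that `Htilde` is insulating at `E`, so it has a gap
  -- there as well.
  obtain ⟨δ₂, hδ₂, hgap₂⟩ := Coarse.IsInsulating.exists_gap hE'
  have hδ : 0 < min δ₁ δ₂ := lt_min hδ₁ hδ₂
  -- One function must serve both operators, because adaptedness compares `f(H)` and `f(Htilde)` for
  -- the same `f`. Hence the smaller of the two gaps is taken, and `min 0 c` as a common lower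
  -- bound: `0` for the positive operator `H` and `c` for `Htilde`.
  obtain ⟨f, hf1, hf0⟩ := Coarse.exists_cutoff (min 0 c) E hδ
  have hp : Coarse.fc H f = Coarse.fermiProjection H E :=
    Coarse.fc_eq_fermiProjection hH.isSelfAdjoint (c := 0)
      (fun x => by simpa using hH.nonneg x)
      (fun t ht => hgap₁ t (ht.trans_le (min_le_left _ _)))
      (fun t ht => hf1 t ((min_le_left _ _).trans ht)) hf0
  have hq : Coarse.fc Htilde f = Coarse.fermiProjection Htilde E :=
    Coarse.fc_eq_fermiProjection hHtilde.isSelfAdjoint hc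
      (fun t ht => hgap₂ t (ht.trans_le (min_le_right _ _)))
      (fun t ht => hf1 t ((min_le_right _ _).trans ht)) hf0
  -- Adaptedness is used only for this `f`. After rewriting, it says that the extended Fermi
  -- projection of `Htilde` is in `I` and differs from `p_E` by an element of `J`.
  have hI := hHtilde.fc_mem f
  have hJ := hHtilde.sub_mem f
  rw [hp, hq] at hJ
  rw [hq] at hI
  have hproj := Coarse.isStarProjection_extend j
    (Coarse.isStarProjection_fermiProjection Htilde E)
  -- Extending by zero along `j` keeps the Fermi projection of `Htilde` a projection, so it is a
  -- projection in `I` lifting the image of `p_E` modulo `J`. The boundary of `[p_E]` is then zero,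
  -- against `hne`.
  exact hne ((M.isMayerVietoris Y).boundary_ofProjection_eq_zero
    (q := ⟨_, M.localizedRoe_le _ hI⟩) _
    ⟨Subtype.ext hproj.isIdempotentElem.eq, Subtype.ext hproj.isSelfAdjoint.star_eq⟩ hI hJ)
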